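/- Let $\ell = 2k+1 \ge 5$ be an odd integer, write $e(x) = e^{2\pi i x}$, $q^x = e(x\tau)$, $\zeta_\ell = e(1/\ell)$ and $\zeta_\ell^{-j/2} = e(-j/(2\ell))$. For $0 < a < 1$ let $$g_{(a,0)}(\tau) = -q^{\frac12\left(a^2 - a + \frac16\right)} \prod_{n=1}^\infty (1 - q^{n-1+a})(1 - q^{n-a})$$ be the Siegel function on the upper half-plane $\mathbb{H}$, and for $1 \le m \le k-1$ let $$s_{\ell,m}(\tau) = \prod_{j=1}^m \frac{g_{(2j/\ell,0)}(\ell\tau)}{g_{(j/\ell,0)}(\ell\tau)}.$$ Let $\mathbb{Q}(\zeta_\ell)^+$ be the maximal real subfield of $\mathbb{Q}(\zeta_\ell)$. Its cyclotomic unit group is the group of those units of its ring of integers that lie in the multiplicative group generated by $\pm\zeta_\ell$ and the numbers $1 - \zeta_\ell^a$, $1 \le a \le \ell-1$. (1) For every $1 \le m \le k-1$, as $\tau$ tends to the cusp $0$ (that is, as $\mathrm{Im}(-1/\tau) \to \infty$), $$\lim_{\tau \to 0} s_{\ell,m}(\tau) = \prod_{j=1}^m \zeta_\ell^{-\frac{j}{2}}\,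 \frac{1 - \zeta_\ell^{2j}}{1 - \zeta_\ell^{j}},$$ and this value lies in the cyclotomic unit group of $\mathbb{Q}(\zeta_\ell)^+$. (2) If moreover $\ell$ is prime, then the subgroup of $\mathbb{C}^\times$ generated by these $k-1$ values has the same rank as the multiplicative group of functions $U_\ell^R = \langle s_{\ell,m} : 1 \le m \le k-1\rangle$. -/

import Mathlib

open Complex UpperHalfPlane Filter Topology NumberField

noncomputable section

/-- `e(z) = exp (2 π i z)`. -/
def e (z : ℂ) : ℂ := Complex.exp (2 * Real.pi * Complex.I * z)

/-- The second Bernoulli polynomial, evaluated at the fractional part of its argument. -/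
def bernoulliTwo (x : ℝ) : ℝ := Int.fract x ^ 2 - Int.fract x + 1 / 6

/-- The Siegel function `g_a(τ)`, `a = (a₁, a₂)`, as a `q`-product with `q ^ x = e(x τ)`.  The product
is indexed by `n - 1 = 0, 1, 2, …`. -/
def siegel (a₁ a₂ : ℝ) (τ : ℂ) : ℂ :=
  -e (bernoulliTwo a₁ / 2 * τ) * e (a₂ * (a₁ - 1) / 2) *
    ∏' n : ℕ, (1 - e ((n + a₁) * τ) * e a₂) * (1 - e ((n + 1 - a₁) * τ) * e (-a₂))

/-- `s_{ℓ,m}(τ) = ∏_{j=1}^m g_{(2j/ℓ,0)}(ℓτ) / g_{(j/ℓ,0)}(ℓτ)` on the upper half-plane. -/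
def sFun (ℓ m : ℕ) (τ : ℍ) : ℂ :=
  ∏ j ∈ Finset.Icc 1 m,
    siegel (2 * j / ℓ) 0 (ℓ * (τ : ℂ)) / siegel (j / ℓ) 0 (ℓ * (τ : ℂ))

lemma norm_e (x : ℝ) (τ : ℂ) : ‖e (x * τ)‖ = Real.exp (-(2 * Real.pi * τ.im) * x) := by
  rw [e, Complex.norm_exp]
  congr 1
  simp
  ring

lemma tprod_one_sub_e_ne_zero (x : ℝ) (hx : 0 < x) {τ : ℂ} (hτ : 0 < τ.im) :
    (Multipliable fun n : ℕ ↦ 1 - e ((n + x) * τ)) ∧ ∏' n : ℕ, (1 - e ((n + x) * τ)) ≠ 0 := by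
  have hn : ∀ n : ℕ, ‖e ((n + x) * τ)‖ =
      Real.exp (-(2 * Real.pi * τ.im) * x) * Real.exp (-(2 * Real.pi * τ.im)) ^ n := by
    intro n
    have := norm_e (n + x) τ
    push_cast at this
    rw [this, ← Real.exp_nat_mul, ← Real.exp_add]
    congr 1
    ring
  have hpos : 0 < 2 * Real.pi * τ.im := by positivity
  have hs : Summable fun n : ℕ ↦ ‖-e ((n + x) * τ)‖ := by
    simp only [norm_neg, hn]
    refine (summable_geometric_of_lt_one (Real.exp_pos _).le ?_).mul_left _
    exact Real.exp_zero ▸ Real.exp_lt_exp.mpr (by linarith)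
  refine ⟨by simpa only [sub_eq_add_neg] using multipliable_one_add_of_summable hs, ?_⟩
  simp only [sub_eq_add_neg]
  refine tprod_one_add_ne_zero_of_summable (fun n ↦ ?_) hs
  intro h
  have h1 : e ((n + x) * τ) = 1 := by linear_combination -h
  have h2 := norm_e (n + x) τ
  push_cast at h2
  rw [h1, norm_one] at h2
  have : Real.exp (-(2 * Real.pi * τ.im) * (n + x)) < 1 := by
    rw [← Real.exp_zero, Real.exp_lt_exp]
    have : 0 < (n : ℝ) + x := by positivity
    nlinarith
  linarith

lemma siegel_ne_zero {a : ℝ} (h0 : 0 < a) (h1 : a < 1) {τ : ℂ} (hτ : 0 < τ.im) :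
    siegel a 0 τ ≠ 0 := by
  have A := tprod_one_sub_e_ne_zero a h0 hτ
  have B := tprod_one_sub_e_ne_zero (1 - a) (by linarith) hτ
  have hfun : (fun n : ℕ ↦ (1 - e ((n + a) * τ) * e (0 : ℝ)) *
      (1 - e ((n + 1 - a) * τ) * e (-(0 : ℝ)))) =
      fun n : ℕ ↦ (1 - e ((n + a) * τ)) * (1 - e ((n + (1 - a : ℝ)) * τ)) := by
    funext n
    have : e 0 = 1 := by simp [e]
    push_cast
    rw [neg_zero, this, mul_one, mul_one, add_sub_assoc]
  rw [siegel, hfun, Multipliable.tprod_mul A.1 B.1]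
  refine mul_ne_zero (mul_ne_zero (neg_ne_zero.mpr (Complex.exp_ne_zero _))
    (Complex.exp_ne_zero _)) (mul_ne_zero A.2 B.2)

lemma sFun_ne_zero {ℓ m : ℕ} (h : 2 * m < ℓ) (τ : ℍ) : sFun ℓ m τ ≠ 0 := by
  refine Finset.prod_ne_zero_iff.mpr fun j hj ↦ ?_
  rw [Finset.mem_Icc] at hj
  have hℓ : (0 : ℝ) < ℓ := by exact_mod_cast (by omega : 0 < ℓ)
  have hj0 : (0 : ℝ) < j := by exact_mod_cast (by omega : 0 < j)
  have hj1 : (2 * j : ℝ) < ℓ := by exact_mod_cast (by omega : 2 * j < ℓ)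
  have hτ : 0 < ((ℓ : ℂ) * (τ : ℂ)).im := by
    simpa using mul_pos hℓ τ.im_pos
  refine div_ne_zero (siegel_ne_zero (by positivity) ?_ hτ) (siegel_ne_zero (by positivity) ?_ hτ)
  · rw [div_lt_one hℓ]; exact hj1
  · rw [div_lt_one hℓ]; linarith

/-- `s_{ℓ,m}` as an element of the multiplicative group of nowhere vanishing functions on `ℍ`. -/
def sUnit (ℓ m : ℕ) (h : 2 * m < ℓ) : (ℍ → ℂ)ˣ where
  val := sFun ℓ m
  inv := (sFun ℓ m)⁻¹
  val_inv := by funext τ; exact mul_inv_cancel₀ (sFun_ne_zero h τ)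
  inv_val := by funext τ; exact inv_mul_cancel₀ (sFun_ne_zero h τ)

/-- `U_ℓ^R`, for `ℓ = 2k+1`: the group of modular units generated by the `s_{ℓ,m}`,
`1 ≤ m ≤ k - 1`. -/
def groupUR (k : ℕ) : Subgroup (ℍ → ℂ)ˣ :=
  Subgroup.closure {u | ∃ m : ℕ, ∃ h : 2 * m < 2 * k + 1,
    1 ≤ m ∧ m + 1 ≤ k ∧ u = sUnit (2 * k + 1) m h}

/-- The filter of neighbourhoods of the cusp `0` in `ℍ`, generated by the horodiscs
`{τ | A < Im (-1/τ)}` tangent to the real line at `0`. -/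
def atCuspZero : Filter ℍ := atImInfty.comap fun τ ↦ ModularGroup.S • τ

/-- `ζ_ℓ = exp (2 π i / ℓ)`. -/
def zeta (ℓ : ℕ) : ℂ := e (1 / ℓ)

/-- `∏_{j=1}^m ζ_ℓ^{-j/2} (1 - ζ_ℓ^{2j}) / (1 - ζ_ℓ^j)`, where `ζ_ℓ^{-j/2} = exp (-π i j / ℓ)`. -/
def cuspValue (ℓ m : ℕ) : ℂ :=
  ∏ j ∈ Finset.Icc 1 m, e (-(j / (2 * ℓ))) * ((1 - zeta ℓ ^ (2 * j)) / (1 - zeta ℓ ^ j))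

/-- `ℚ(ζ_ℓ)⁺`, the maximal real subfield `ℚ(ζ_ℓ) ∩ ℝ` of the cyclotomic field. -/
def cyclotomicRealField (ℓ : ℕ) : IntermediateField ℚ ℂ :=
  IntermediateField.adjoin ℚ {zeta ℓ} ⊓ (⊥ : IntermediateField ℝ ℂ).restrictScalars ℚ

/-- The group of cyclotomic units of `ℚ(ζ_ℓ)⁺`: the elements of the multiplicative group generated
by `±ζ_ℓ` and the `1 - ζ_ℓ^a`, `1 ≤ a ≤ ℓ - 1`, that are units of the ring of integers of
`ℚ(ζ_ℓ)⁺`. -/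
def cyclotomicUnits (ℓ : ℕ) : Subgroup ℂˣ :=
  Subgroup.closure {u : ℂˣ | (u : ℂ) = zeta ℓ ∨ (u : ℂ) = -zeta ℓ ∨
      ∃ a : ℕ, 1 ≤ a ∧ a < ℓ ∧ (u : ℂ) = 1 - zeta ℓ ^ a} ⊓
    (Units.map (algebraMap (𝓞 (cyclotomicRealField ℓ)) ℂ).toMonoidHom).range

/-- The group generated by the values `cuspValue ℓ m`, `1 ≤ m ≤ k - 1`, for `ℓ = 2k+1`. -/
def groupCuspValues (k : ℕ) : Subgroup ℂˣ :=
  Subgroup.closure {u | ∃ m : ℕ, 1 ≤ m ∧ m + 1 ≤ k ∧ (u : ℂ) = cuspValue (2 * k + 1) m}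

/-- The rank of a commutative group `G`: the rank of `G` as a `ℤ`-module. -/
def abRank (G : Type*) [CommGroup G] : Cardinal := Module.rank ℤ (Additive G)

end

noncomputable section

/-!
By Jacobi's triple product, `g_(a,0)(τ)` is, up to a factor that does not depend on `a` and cancels
in `s_{ℓ,m}`, a power of `q` times a theta series. The inversion formula of the theta function turns
it into `e(-a/2)` times the series `∑ (-1)^n Q^(n(n-1)/2) e(na)` with `Q = e(-1/τ)`, which tends to
`1 - e(a)` as `Q → 0`; this gives the limits. The factors `ζ_ℓ^{-j/2} (1 + ζ_ℓ^j) = 2 cos(πj/ℓ)`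
are real, lie in `ℚ(ζ_ℓ)` because `ℓ` is odd, and are units because `2` is invertible modulo `ℓ`.

For `ℓ = p` prime the limits and the functions satisfy the same multiplicative relations, so the
ranks agree. A relation between the functions passes to the limit. Conversely, let `D` be the
divisor on `ℤ/p` that records the exponents of the `1 - ζ_p^a` in a relation between the limits.
Applying the Galois automorphisms and taking logarithms of absolute values yields
`∑_a D(a) log |1 - ζ_p^(ab)| = 0` for all `b ≠ 0`. A sum over `b` against an even character `χ ≠ 1`
factors as `(∑_a D(a) χ⁻¹(a)) (∑_c χ(c) log |1 - ζ_p^c|)`, whose second factor is a nonzero multiple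
of `L(1, χ⁻¹) ≠ 0`. As `∑_a D(a) = 0`, the even part of `D` is orthogonal to all characters, so `D`
is odd, which is a relation between the Siegel functions because `g_(1-a,0) = g_(a,0)`.
-/

/-- The finite `q`-Pochhammer symbol `(q; q)_m = ∏_{i=1}^m (1 - q^i)`. -/
def qPoch {K : Type*} [CommRing K] (q : K) (m : ℕ) : K := ∏ i ∈ Finset.range m, (1 - q ^ (i + 1))

/-- `1 / (q; q)_m` for an integer index `m`, with the convention `1 / (q; q)_m = 0` for `m < 0`
that makes the recursion `invQPoch_sub_one` hold for every `m`. -/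
def invQPoch {K : Type*} [Field K] (q : K) (m : ℤ) : K :=
  if m < 0 then 0 else (qPoch q m.toNat)⁻¹

/-- The infinite `q`-Pochhammer symbol `(q; q)_∞ = ∏_{i ≥ 1} (1 - q^i)`. -/
def qPochInfty {K : Type*} [CommRing K] [TopologicalSpace K] (q : K) : K :=
  ∏' i : ℕ, (1 - q ^ (i + 1))

/-- The `q`-binomial coefficient of `2N` over `N + n`, which is `0` for `|n| > N`. -/
def centralQBinom {K : Type*} [Field K] (q : K) (N : ℕ) (n : ℤ) : K :=
  qPoch q (2 * N) * (invQPoch q (N + n) * invQPoch q (N - n))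

/-- The `n`-th term of Jacobi's theta series `∑ (-1)^n q^(n(n-1)/2) x^n`. -/
def thetaTerm {K : Type*} [Field K] (q x : K) (n : ℤ) : K :=
  (-1) ^ n * q ^ (n * (n - 1) / 2) * x ^ n

/-- Jacobi's theta series `∑ (-1)^n q^(n(n-1)/2) x^n` over all integers `n`. -/
def thetaSeries {K : Type*} [Field K] [TopologicalSpace K] (q x : K) : K :=
  ∑' n : ℤ, thetaTerm q x n

section TripleProduct

variable {K : Type*} [NormedField K] {q x : K}

lemma one_sub_pow_succ_ne_zero (hq : ‖q‖ < 1) (i : ℕ) : 1 - q ^ (i + 1) ≠ 0 := by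
  intro h
  have h1 : ‖q ^ (i + 1)‖ < 1 := norm_pow q _ ▸ pow_lt_one₀ (norm_nonneg _) hq i.succ_ne_zero
  rw [← sub_eq_zero.mp h, norm_one] at h1
  exact lt_irrefl _ h1

lemma qPoch_succ (q : K) (m : ℕ) : qPoch q (m + 1) = qPoch q m * (1 - q ^ (m + 1)) :=
  Finset.prod_range_succ _ _

lemma invQPoch_sub_one (hq : ‖q‖ < 1) (m : ℤ) :
    invQPoch q (m - 1) = (1 - q ^ m) * invQPoch q m := by
  rcases lt_trichotomy m 0 with h | rfl | h
  · simp [invQPoch, h, show m - 1 < 0 by omega]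
  · simp [invQPoch]
  · lift m to ℕ using h.le
    obtain ⟨n, rfl⟩ := Nat.exists_eq_succ_of_ne_zero (by omega : m ≠ 0)
    have hn := one_sub_pow_succ_ne_zero hq n
    rw [Nat.cast_succ, add_sub_cancel_right, invQPoch, invQPoch, if_neg (by omega),
      if_neg (by omega), ← Nat.cast_succ, Int.toNat_natCast, Int.toNat_natCast, qPoch_succ,
      mul_inv, zpow_natCast]
    field_simp

lemma centralQBinom_succ (hq : ‖q‖ < 1) (hq0 : q ≠ 0) (N : ℕ) (n : ℤ) :
    centralQBinom q (N + 1) n = (1 + q ^ (2 * N + 1)) * centralQBinom q N n +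
      q ^ ((N : ℤ) + 1 - n) * centralQBinom q N (n - 1) +
      q ^ ((N : ℤ) + 1 + n) * centralQBinom q N (n + 1) := by
  set u : K := q ^ ((N : ℤ) + 1 + n) with hu
  set v : K := q ^ ((N : ℤ) + 1 - n) with hv
  have huv : q ^ (2 * N + 1 + 1) = u * v := by
    rw [hu, hv, ← zpow_add₀ hq0, ← zpow_natCast]
    congr 1
    push_cast
    ring
  have huv' : q ^ (2 * N + 1) = u * v / q := by
    rw [← huv, pow_succ _ (2 * N + 1), mul_div_assoc, div_self hq0, mul_one]
  have hplus : invQPoch q (N + n) = (1 - u) * invQPoch q (N + 1 + n) := by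
    rw [hu, ← invQPoch_sub_one hq]; congr 1; ring
  have hminus : invQPoch q (N - n) = (1 - v) * invQPoch q (N + 1 - n) := by
    rw [hv, ← invQPoch_sub_one hq]; congr 1; ring
  have hplus' : invQPoch q (N + (n - 1)) = (1 - u / q) * invQPoch q (N + n) := by
    rw [hu, div_eq_mul_inv, ← zpow_sub_one₀ hq0, show (N : ℤ) + 1 + n - 1 = N + n by ring,
      ← invQPoch_sub_one hq]
    congr 1; ring
  have hminus' : invQPoch q (N - (n + 1)) = (1 - v / q) * invQPoch q (N - n) := by
    rw [hv, div_eq_mul_inv, ← zpow_sub_one₀ hq0, show (N : ℤ) + 1 - n - 1 = N - n by ring,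
      ← invQPoch_sub_one hq]
    congr 1; ring
  simp only [centralQBinom]
  rw [show 2 * (N + 1) = 2 * N + 1 + 1 by ring, qPoch_succ, qPoch_succ,
    show (N : ℤ) - (n - 1) = N + 1 - n by ring, show (N : ℤ) + (n + 1) = N + 1 + n by ring,
    hplus', hminus', hplus, hminus, huv, huv', Nat.cast_succ]
  field_simp
  ring

lemma thetaTerm_zero (q x : K) : thetaTerm q x 0 = 1 := by simp [thetaTerm]

lemma thetaTerm_succ (hq0 : q ≠ 0) (hx : x ≠ 0) (n : ℤ) :
    thetaTerm q x (n + 1) = -q ^ n * x * thetaTerm q x n := by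
  have hn : (n + 1) * (n + 1 - 1) / 2 = n * (n - 1) / 2 + n := by
    rw [show (n + 1) * (n + 1 - 1) = n * (n - 1) + n * 2 by ring,
      Int.add_mul_ediv_right _ _ two_ne_zero]
  rw [thetaTerm, thetaTerm, hn, zpow_add₀ hq0, zpow_add_one₀ hx, zpow_add_one₀ (by simp)]
  ring

lemma thetaTerm_neg (hq0 : q ≠ 0) (n : ℤ) : thetaTerm q x (-n) = thetaTerm q (q / x) n := by
  have hn : -n * (-n - 1) / 2 = n * (n - 1) / 2 + n := by
    rw [show -n * (-n - 1) = n * (n - 1) + n * 2 by ring, Int.add_mul_ediv_right _ _ two_ne_zero]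
  rw [thetaTerm, thetaTerm, hn, zpow_add₀ hq0, div_zpow, zpow_neg, zpow_neg, ← inv_zpow,
    show (-1 : K)⁻¹ = -1 by norm_num]
  ring

lemma summable_norm_thetaTerm_natCast (hq : ‖q‖ < 1) (hq0 : q ≠ 0) (hx : x ≠ 0) :
    Summable fun n : ℕ ↦ ‖thetaTerm q x n‖ := by
  have hne (n : ℕ) : thetaTerm q x n ≠ 0 := by simp [thetaTerm, zpow_ne_zero, hq0, hx]
  refine summable_of_ratio_test_tendsto_lt_one zero_lt_one
    (Eventually.of_forall fun n ↦ norm_ne_zero_iff.mpr (hne n)) ?_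
  have hlim := (tendsto_pow_atTop_nhds_zero_of_lt_one (norm_nonneg q) hq).mul_const ‖x‖
  rw [zero_mul] at hlim
  refine hlim.congr fun n ↦ ?_
  rw [norm_norm, norm_norm, Nat.cast_succ, thetaTerm_succ hq0 hx, norm_mul, norm_mul, norm_neg,
    zpow_natCast, norm_pow, mul_div_cancel_right₀ _ (norm_ne_zero_iff.mpr (hne n))]

lemma summable_norm_thetaTerm (hq : ‖q‖ < 1) (hq0 : q ≠ 0) (hx : x ≠ 0) :
    Summable fun n : ℤ ↦ ‖thetaTerm q x n‖ := by
  refine .of_nat_of_neg (summable_norm_thetaTerm_natCast hq hq0 hx) ?_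
  simpa only [thetaTerm_neg hq0] using
    summable_norm_thetaTerm_natCast hq hq0 (div_ne_zero hq0 hx)

lemma thetaSeries_zero_left (x : K) : thetaSeries 0 x = 1 - x := by
  rw [thetaSeries, tsum_eq_sum (s := {0, 1})]
  · simp [thetaTerm, sub_eq_add_neg]
  · intro n hn
    have hexp : n * (n - 1) / 2 ≠ 0 := by
      simp only [Finset.mem_insert, Finset.mem_singleton, not_or] at hn
      have : 2 ≤ n * (n - 1) := by
        rcases lt_or_gt_of_ne hn.1 with h | h
        · nlinarith
        · nlinarith [show 2 ≤ n by omega]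
      omega
    simp [thetaTerm, zero_zpow _ hexp]

lemma hasSum_thetaTerm_mul_centralQBinom (hq : ‖q‖ < 1) (hq0 : q ≠ 0) (hx : x ≠ 0) (N : ℕ) :
    HasSum (fun n ↦ thetaTerm q x n * centralQBinom q N n)
      (∏ i ∈ Finset.range N, (1 - q ^ i * x) * (1 - q ^ (i + 1) / x)) := by
  induction N with
  | zero =>
    convert hasSum_single (f := fun n ↦ thetaTerm q x n * centralQBinom q 0 n) 0 ?_ using 1
    · simp [centralQBinom, thetaTerm_zero, invQPoch, qPoch]
    · intro n hn
      rcases lt_or_gt_of_ne hn with h | h <;> simp [centralQBinom, invQPoch, h]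
  | succ N ih =>
    have hlow := ((Equiv.subRight (1 : ℤ)).hasSum_iff.mpr ih).mul_left (-(q ^ N * x))
    have hup := ((Equiv.addRight (1 : ℤ)).hasSum_iff.mpr ih).mul_left (-(q ^ (N + 1) / x))
    refine (congrArg₂ HasSum (funext fun n ↦ ?_) ?_).mpr
      (((ih.mul_left (1 + q ^ (2 * N + 1))).add hlow).add hup)
    · have hpred : q ^ N * x * thetaTerm q x (n - 1) =
          -q ^ ((N : ℤ) + 1 - n) * thetaTerm q x n := by
        have h := thetaTerm_succ hq0 hx (n - 1)
        rw [sub_add_cancel] at h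
        rw [h, show (N : ℤ) + 1 - n = N - (n - 1) by ring, zpow_sub₀ hq0, zpow_natCast]
        field_simp [zpow_ne_zero (n - 1) hq0]
      have hsucc : q ^ (N + 1) / x * thetaTerm q x (n + 1) =
          -q ^ ((N : ℤ) + 1 + n) * thetaTerm q x n := by
        rw [thetaTerm_succ hq0 hx, zpow_add₀ hq0, ← Nat.cast_succ, zpow_natCast]
        field_simp
      simp only [Function.comp, Equiv.subRight_apply, Equiv.coe_addRight]
      rw [centralQBinom_succ hq hq0]
      linear_combination
        centralQBinom q N (n - 1) * hpred + centralQBinom q N (n + 1) * hsucc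
    · rw [Finset.prod_range_succ, two_mul, pow_succ, pow_succ, pow_add]
      generalize ∏ i ∈ Finset.range N, (1 - q ^ i * x) * (1 - q ^ (i + 1) / x) = P
      field_simp
      ring

lemma summable_norm_pow_succ (hq : ‖q‖ < 1) : Summable fun i : ℕ ↦ ‖-q ^ (i + 1)‖ := by
  simpa only [norm_neg, norm_pow, pow_succ, norm_mul] using
    (summable_geometric_of_lt_one (norm_nonneg _) hq).mul_right ‖q‖

variable [CompleteSpace K]

lemma multipliable_one_sub_pow_mul (hq : ‖q‖ < 1) (x : K) :
    Multipliable fun n : ℕ ↦ 1 - q ^ n * x := by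
  simp only [sub_eq_add_neg]
  refine multipliable_one_add_of_summable ?_
  simpa only [norm_neg, norm_mul, norm_pow] using
    (summable_geometric_of_lt_one (norm_nonneg _) hq).mul_right ‖x‖

lemma tendsto_qPoch (hq : ‖q‖ < 1) : Tendsto (qPoch q) atTop (𝓝 (qPochInfty q)) := by
  have h := (multipliable_one_sub_pow_mul hq q).tendsto_prod_tprod_nat
  simpa only [← pow_succ] using! h

lemma qPochInfty_ne_zero (hq : ‖q‖ < 1) : qPochInfty q ≠ 0 := by
  have h := tprod_one_add_ne_zero_of_summable (f := fun i : ℕ ↦ -q ^ (i + 1))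
    (fun i ↦ by simpa only [← sub_eq_add_neg] using one_sub_pow_succ_ne_zero hq i)
    (summable_norm_pow_succ hq)
  simpa only [← sub_eq_add_neg] using! h

lemma tendsto_invQPoch (hq : ‖q‖ < 1) :
    Tendsto (invQPoch q) atTop (𝓝 (qPochInfty q)⁻¹) := by
  have hnat : Tendsto Int.toNat atTop atTop :=
    tendsto_atTop_atTop.mpr fun b ↦ ⟨b, fun a ha ↦ by omega⟩
  refine (((tendsto_qPoch hq).comp hnat).inv₀ (qPochInfty_ne_zero hq)).congr' ?_
  filter_upwards [eventually_ge_atTop 0] with m hm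
  rw [invQPoch, if_neg (not_lt.mpr hm), Function.comp_apply]

lemma tendsto_centralQBinom (hq : ‖q‖ < 1) (n : ℤ) :
    Tendsto (fun N ↦ centralQBinom q N n) atTop (𝓝 (qPochInfty q)⁻¹) := by
  have hnum : Tendsto (fun N : ℕ ↦ qPoch q (2 * N)) atTop (𝓝 (qPochInfty q)) :=
    (tendsto_qPoch hq).comp (tendsto_id.const_mul_atTop' two_pos)
  have hden (j : ℤ) : Tendsto (fun N : ℕ ↦ invQPoch q (N + j)) atTop (𝓝 (qPochInfty q)⁻¹) :=
    (tendsto_invQPoch hq).comp (tendsto_atTop_add_const_right _ j tendsto_natCast_atTop_atTop)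
  have h := hnum.mul ((hden n).mul (hden (-n)))
  rwa [mul_inv_cancel_left₀ (qPochInfty_ne_zero hq)] at h

lemma exists_norm_centralQBinom_le (hq : ‖q‖ < 1) :
    ∃ M : ℝ, ∀ N n, ‖centralQBinom q N n‖ ≤ M := by
  have h := tendsto_qPoch hq
  obtain ⟨A, hA⟩ := (Metric.isBounded_range_of_tendsto _ h).exists_norm_le
  obtain ⟨B, hB⟩ :=
    (Metric.isBounded_range_of_tendsto _ (h.inv₀ (qPochInfty_ne_zero hq))).exists_norm_le
  have hA0 : 0 ≤ A := (norm_nonneg _).trans (hA _ ⟨0, rfl⟩)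
  have hB0 : 0 ≤ B := (norm_nonneg _).trans (hB _ ⟨0, rfl⟩)
  have hinv (m : ℤ) : ‖invQPoch q m‖ ≤ B := by
    rw [invQPoch]
    split_ifs
    exacts [norm_zero.trans_le hB0, hB _ ⟨_, rfl⟩]
  refine ⟨A * (B * B), fun N n ↦ ?_⟩
  rw [centralQBinom, norm_mul, norm_mul]
  exact mul_le_mul (hA _ ⟨_, rfl⟩)
    (mul_le_mul (hinv _) (hinv _) (norm_nonneg _) hB0) (by positivity) hA0

/-- **Jacobi's triple product identity**. -/
theorem qPochInfty_mul_tprod_eq_thetaSeries (hq : ‖q‖ < 1) (hq0 : q ≠ 0) (hx : x ≠ 0) :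
    qPochInfty q * ∏' n : ℕ, (1 - q ^ n * x) * (1 - q ^ (n + 1) / x) = thetaSeries q x := by
  obtain ⟨M, hM⟩ := exists_norm_centralQBinom_le hq
  have hsum := summable_norm_thetaTerm hq hq0 hx
  have hseries : Tendsto (fun N ↦ ∏ i ∈ Finset.range N, (1 - q ^ i * x) * (1 - q ^ (i + 1) / x))
      atTop (𝓝 (thetaSeries q x * (qPochInfty q)⁻¹)) := by
    rw [thetaSeries, ← tsum_mul_right]
    simp_rw [← fun N ↦ (hasSum_thetaTerm_mul_centralQBinom hq hq0 hx N).tsum_eq]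
    refine tendsto_tsum_of_dominated_convergence (hsum.mul_right M)
      (fun n ↦ (tendsto_centralQBinom hq n).const_mul _) (Eventually.of_forall fun N n ↦ ?_)
    rw [norm_mul]
    exact mul_le_mul_of_nonneg_left (hM N n) (norm_nonneg _)
  have hprod := ((multipliable_one_sub_pow_mul hq x).mul
    (multipliable_one_sub_pow_mul hq (q / x))).tendsto_prod_tprod_nat
  simp only [← mul_div_assoc, ← pow_succ] at hprod
  rw [tendsto_nhds_unique hprod hseries, mul_comm,
    inv_mul_cancel_right₀ (qPochInfty_ne_zero hq)]

lemma continuousAt_thetaSeries_zero (hx : x ≠ 0) :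
    ContinuousAt (fun q : K ↦ thetaSeries q x) 0 := by
  have hexp (n : ℤ) : 0 ≤ n * (n - 1) / 2 :=
    Int.ediv_nonneg (by rcases le_or_gt n 0 with h | h <;> nlinarith) zero_le_two
  refine (continuousOn_tsum (s := Metric.closedBall 0 (1 / 2))
    (u := fun n ↦ ‖thetaTerm (1 / 2 : ℝ) ‖x‖ n‖) (fun n q _ ↦ ?_) ?_ fun n q hq ↦ ?_).continuousAt
    (Metric.closedBall_mem_nhds _ one_half_pos)
  · exact ((continuousAt_const.mul (continuousAt_zpow₀ q _ (.inr (hexp n)))).mul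
      continuousAt_const).continuousWithinAt
  · exact summable_norm_thetaTerm (by norm_num) (by norm_num) (norm_ne_zero_iff.mpr hx)
  · rw [mem_closedBall_zero_iff] at hq
    simp only [thetaTerm, norm_mul, norm_zpow, norm_neg, norm_one, one_zpow, one_mul, norm_norm]
    gcongr
    lift n * (n - 1) / 2 to ℕ using hexp n with d
    rw [zpow_natCast, zpow_natCast]
    gcongr
    simpa using hq

end TripleProduct

section SiegelCusp

lemma e_add (x y : ℂ) : e (x + y) = e x * e y := by
  rw [e, e, e, ← Complex.exp_add, mul_add]

lemma e_zero : e 0 = 1 := by rw [e, mul_zero, Complex.exp_zero]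

lemma e_one : e 1 = 1 := by rw [e, mul_one, Complex.exp_two_pi_mul_I]

lemma e_half : e (1 / 2) = -1 := by
  rw [e, ← Complex.exp_pi_mul_I]
  ring_nf

lemma e_ne_zero (x : ℂ) : e x ≠ 0 := Complex.exp_ne_zero _

lemma e_neg (x : ℂ) : e (-x) = (e x)⁻¹ := by
  rw [e, e, ← Complex.exp_neg, mul_neg]

lemma e_int_mul (n : ℤ) (x : ℂ) : e (n * x) = e x ^ n := by
  rw [e, e, ← Complex.exp_int_mul, mul_left_comm]

lemma e_nat_mul (n : ℕ) (x : ℂ) : e (n * x) = e x ^ n := mod_cast e_int_mul n x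

lemma norm_e_lt_one {w : ℂ} (hw : 0 < w.im) : ‖e w‖ < 1 := by
  have h := norm_e 1 w
  rw [ofReal_one, one_mul] at h
  rw [h, Real.exp_lt_one_iff, mul_one, neg_lt_zero]
  positivity

lemma thetaTerm_e (w z : ℂ) (n : ℤ) :
    thetaTerm (e w) (e z) n = jacobiTheta₂_term n (z + 1 / 2 - w / 2) w := by
  obtain ⟨d, hd⟩ := Int.even_mul_pred_self n
  have hdiv : n * (n - 1) / 2 = d := by omega
  have hd' : (n : ℂ) * (n - 1) = d + d := mod_cast hd
  rw [thetaTerm, hdiv, ← e_half, ← e_int_mul, ← e_int_mul, ← e_int_mul, ← e_add, ← e_add,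
    jacobiTheta₂_term, e]
  congr 1
  linear_combination (-Real.pi * Complex.I * w) * hd'

lemma thetaSeries_e (w z : ℂ) :
    thetaSeries (e w) (e z) = jacobiTheta₂ (z + 1 / 2 - w / 2) w :=
  tsum_congr (thetaTerm_e w z)

lemma bernoulliTwo_of_mem_Ico {a : ℝ} (ha : a ∈ Set.Ico 0 1) :
    bernoulliTwo a = (a - 1 / 2) ^ 2 - 1 / 12 := by
  rw [bernoulliTwo, Int.fract_eq_self.mpr ha]
  ring

lemma siegel_mul_qPochInfty {w : ℂ} (hw : 0 < w.im) (a : ℝ) :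
    siegel a 0 w * qPochInfty (e w) =
      -e (bernoulliTwo a / 2 * w) * thetaSeries (e w) (e (a * w)) := by
  rw [← qPochInfty_mul_tprod_eq_thetaSeries (norm_e_lt_one hw) (e_ne_zero w) (e_ne_zero _),
    siegel]
  have hfactor (n : ℕ) :
      (1 - e ((n + a) * w) * e (0 : ℝ)) * (1 - e ((n + 1 - a) * w) * e (-(0 : ℝ))) =
        (1 - e w ^ n * e (a * w)) * (1 - e w ^ (n + 1) / e (a * w)) := by
    rw [ofReal_zero, neg_zero, e_zero, mul_one, mul_one, ← e_nat_mul, ← e_nat_mul,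
      div_eq_mul_inv, ← e_neg, ← e_add, ← e_add]
    push_cast
    ring_nf
  rw [tprod_congr hfactor, ofReal_zero, zero_mul, zero_div, e_zero]
  ring

/-- The factor independent of `a` in the transformation formula of `g_(a,0)` under
`w ↦ -1/w`. -/
def siegelInvFactor (w : ℂ) : ℂ :=
  -(1 / (-Complex.I * w) ^ (1 / 2 : ℂ) * e (-(w / 24) - 1 / (8 * w) + 1 / 4)) /
    qPochInfty (e w)

lemma siegel_eq_thetaSeries_inv {w : ℂ} (hw : 0 < w.im) {a : ℝ} (ha : a ∈ Set.Ico 0 1) :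
    siegel a 0 w = siegelInvFactor w * (e (-(a / 2)) * thetaSeries (e (-1 / w)) (e a)) := by
  have hw0 : w ≠ 0 := by rintro rfl; simp at hw
  have hshift : jacobiTheta₂ ((a * w + 1 / 2 - w / 2) / w) (-1 / w) =
      thetaSeries (e (-1 / w)) (e a) := by
    rw [thetaSeries_e, ← jacobiTheta₂_add_left]
    congr 1
    field_simp
    ring
  have hexp : e (bernoulliTwo a / 2 * w) *
      cexp (-Real.pi * Complex.I * (a * w + 1 / 2 - w / 2) ^ 2 / w) =
        e (-(w / 24) - 1 / (8 * w) + 1 / 4) * e (-(a / 2)) := by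
    rw [← e_add, bernoulliTwo_of_mem_Ico ha, e, e, ← Complex.exp_add]
    congr 1
    push_cast
    field_simp
    ring
  have hmul := siegel_mul_qPochInfty hw a
  rw [thetaSeries_e, jacobiTheta₂_functional_equation, hshift] at hmul
  rw [siegelInvFactor, div_mul_eq_mul_div, eq_div_iff (qPochInfty_ne_zero (norm_e_lt_one hw)),
    hmul]
  linear_combination
    -(1 / (-Complex.I * w) ^ (1 / 2 : ℂ)) * thetaSeries (e (-1 / w)) (e a) * hexp

lemma siegelInvFactor_ne_zero {w : ℂ} (hw : 0 < w.im) : siegelInvFactor w ≠ 0 := by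
  have hw0 : w ≠ 0 := by rintro rfl; simp at hw
  have hcpow : (-Complex.I * w) ^ (1 / 2 : ℂ) ≠ 0 := by
    simp [Complex.cpow_eq_zero_iff, hw0]
  exact div_ne_zero (neg_ne_zero.mpr (mul_ne_zero (one_div_ne_zero hcpow) (e_ne_zero _)))
    (qPochInfty_ne_zero (norm_e_lt_one hw))

lemma siegel_div_siegel {w : ℂ} (hw : 0 < w.im) {a b : ℝ} (ha : a ∈ Set.Ico 0 1)
    (hb : b ∈ Set.Ico 0 1) :
    siegel b 0 w / siegel a 0 w = e ((a - b) / 2) *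
      (thetaSeries (e (-1 / w)) (e b) / thetaSeries (e (-1 / w)) (e a)) := by
  rw [siegel_eq_thetaSeries_inv hw ha, siegel_eq_thetaSeries_inv hw hb,
    mul_div_mul_left _ _ (siegelInvFactor_ne_zero hw), mul_div_mul_comm,
    show ((a - b) / 2 : ℂ) = -(b / 2) + a / 2 by ring, e_add, e_neg, e_neg, div_inv_eq_mul]

lemma tendsto_e_neg_inv_atCuspZero {L : ℝ} (hL : 0 < L) :
    Tendsto (fun τ : ℍ ↦ e (-1 / (L * (τ : ℂ)))) atCuspZero (𝓝 0) := by
  refine ((qParam_tendsto_atImInfty hL).comp tendsto_comap).congr fun τ ↦ ?_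
  rw [Function.comp_apply, Function.Periodic.qParam, modular_S_smul, e]
  congr 1
  have hτ := τ.ne_zero
  have : (L : ℂ) ≠ 0 := mod_cast hL.ne'
  field_simp

lemma tendsto_siegel_div {L a b : ℝ} (hL : 0 < L) (ha : a ∈ Set.Ico 0 1) (hb : b ∈ Set.Ico 0 1)
    (hea : e a ≠ 1) :
    Tendsto (fun τ : ℍ ↦ siegel b 0 (L * (τ : ℂ)) / siegel a 0 (L * (τ : ℂ))) atCuspZero
      (𝓝 (e ((a - b) / 2) * ((1 - e b) / (1 - e a)))) := by
  have htheta (c : ℝ) : Tendsto (fun τ : ℍ ↦ thetaSeries (e (-1 / (L * (τ : ℂ)))) (e c))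
      atCuspZero (𝓝 (1 - e c)) :=
    thetaSeries_zero_left (e c) ▸ (continuousAt_thetaSeries_zero (e_ne_zero c)).tendsto.comp
      (tendsto_e_neg_inv_atCuspZero hL)
  refine (((htheta b).div (htheta a) (sub_ne_zero.mpr hea.symm)).const_mul _).congr fun τ ↦ ?_
  exact (siegel_div_siegel (by simpa using mul_pos hL τ.im_pos) ha hb).symm

lemma zeta_pow (ℓ j : ℕ) : zeta ℓ ^ j = e (j / ℓ) := by
  rw [zeta, ← e_nat_mul, mul_one_div]

lemma zeta_isPrimitiveRoot {ℓ : ℕ} (h : ℓ ≠ 0) : IsPrimitiveRoot (zeta ℓ) ℓ := by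
  simpa only [zeta, e, mul_one_div] using Complex.isPrimitiveRoot_exp ℓ h

lemma tendsto_sFun {ℓ m : ℕ} (h : 2 * m < ℓ) :
    Tendsto (sFun ℓ m) atCuspZero (𝓝 (cuspValue ℓ m)) := by
  refine tendsto_finsetProd _ fun j hj ↦ ?_
  rw [Finset.mem_Icc] at hj
  have hℓ : (0 : ℝ) < ℓ := mod_cast (by omega : 0 < ℓ)
  have hmem (i : ℕ) (hi : i < ℓ) : (i / ℓ : ℝ) ∈ Set.Ico 0 1 :=
    ⟨by positivity, (div_lt_one hℓ).mpr (mod_cast hi)⟩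
  have hne : e ((j / ℓ : ℝ) : ℂ) ≠ 1 := by
    have := (zeta_isPrimitiveRoot (by omega : ℓ ≠ 0)).pow_ne_one_of_pos_of_lt (l := j)
      (by omega) (by omega)
    rw [zeta_pow] at this
    push_cast
    exact this
  have hlim := tendsto_siegel_div hℓ (hmem j (by omega)) (hmem (2 * j) (by omega)) hne
  have hhalf : ((j / ℓ : ℂ) - 2 * j / ℓ) / 2 = -(j / (2 * ℓ)) := by
    have : (ℓ : ℂ) ≠ 0 := mod_cast hℓ.ne'
    field_simp
    ring
  rw [zeta_pow, zeta_pow]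
  push_cast at hlim ⊢
  rwa [hhalf] at hlim

end SiegelCusp

/-- The geometric series `∑_{n ≥ 1} z^n e^(-nt)`, whose Mellin transform at `s` is
`Γ(s) ∑_{n ≥ 1} z^n / n^s`. -/
def polylogKernel (z : ℂ) (t : ℝ) : ℂ :=
  z * (Real.exp (-t) : ℂ) / (1 - z * (Real.exp (-t) : ℂ))

section Polylogarithm

open MeasureTheory

variable {z : ℂ}

lemma re_lt_one_of_norm_le_one (h : ‖z‖ ≤ 1) (hz : z ≠ 1) : z.re < 1 := by
  refine lt_of_le_of_ne ((re_le_norm z).trans h) fun hre ↦ hz (Complex.ext hre ?_)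
  refine abs_re_eq_norm.mp (le_antisymm (abs_re_le_norm z) ?_)
  rwa [hre, abs_one]

lemma re_one_sub_mul_exp_neg_pos (h : ‖z‖ ≤ 1) (hz : z ≠ 1) {t : ℝ} (ht : 0 ≤ t) :
    0 < (1 - z * (Real.exp (-t) : ℂ)).re := by
  have hre := re_lt_one_of_norm_le_one h hz
  have hle : Real.exp (-t) ≤ 1 := Real.exp_le_one_iff.mpr (neg_nonpos.mpr ht)
  rw [sub_re, one_re, re_mul_ofReal]
  nlinarith [Real.exp_pos (-t)]

lemma continuousOn_polylogKernel (h : ‖z‖ ≤ 1) (hz : z ≠ 1) :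
    ContinuousOn (polylogKernel z) (Set.Ici 0) := by
  refine ContinuousOn.div (by fun_prop) (by fun_prop) fun t ht h0 ↦ ?_
  exact (re_one_sub_mul_exp_neg_pos h hz ht).ne' (by rw [h0, zero_re])

lemma locallyIntegrableOn_polylogKernel (h : ‖z‖ ≤ 1) (hz : z ≠ 1) :
    LocallyIntegrableOn (polylogKernel z) (Set.Ioi 0) :=
  ((continuousOn_polylogKernel h hz).mono Set.Ioi_subset_Ici_self).locallyIntegrableOn
    measurableSet_Ioi

lemma polylogKernel_isBigO_zero (h : ‖z‖ ≤ 1) (hz : z ≠ 1) :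
    polylogKernel z =O[𝓝[>] 0] (fun t : ℝ ↦ t ^ (-(0 : ℝ))) := by
  simp only [neg_zero, Real.rpow_zero]
  exact ((continuousOn_polylogKernel h hz 0 Set.self_mem_Ici).mono_left
    (nhdsWithin_mono _ Set.Ioi_subset_Ici_self)).isBigO_one ℝ

lemma tendsto_one_sub_mul_exp_neg (z : ℂ) :
    Tendsto (fun t : ℝ ↦ 1 - z * (Real.exp (-t) : ℂ)) atTop (𝓝 1) := by
  have h := (continuous_ofReal.tendsto (0 : ℝ)).comp Real.tendsto_exp_neg_atTop_nhds_zero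
  simpa using (h.const_mul z).const_sub 1

lemma polylogKernel_isBigO_atTop (z : ℂ) :
    polylogKernel z =O[atTop] (fun t : ℝ ↦ Real.exp (-1 * t)) := by
  have hnum : (fun t : ℝ ↦ z * (Real.exp (-t) : ℂ)) =O[atTop] (fun t ↦ Real.exp (-1 * t)) :=
    .of_bound ‖z‖ (Eventually.of_forall fun t ↦ by rw [norm_mul, norm_real, neg_one_mul])
  have hden : (fun t : ℝ ↦ (1 - z * (Real.exp (-t) : ℂ))⁻¹) =O[atTop] (fun _ ↦ (1 : ℝ)) :=
    ((tendsto_one_sub_mul_exp_neg z).inv₀ one_ne_zero).isBigO_one ℝ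
  exact (hnum.mul hden).congr_right fun t ↦ mul_one _

lemma hasDerivAt_log_one_sub_mul_exp_neg (h : ‖z‖ ≤ 1) (hz : z ≠ 1) {t : ℝ} (ht : 0 ≤ t) :
    HasDerivAt (fun t : ℝ ↦ log (1 - z * (Real.exp (-t) : ℂ))) (polylogKernel z t) t := by
  have hderiv : HasDerivAt (fun t : ℝ ↦ 1 - z * (Real.exp (-t) : ℂ))
      (z * (Real.exp (-t) : ℂ)) t := by
    simpa using ((((Real.hasDerivAt_exp (-t)).comp t (hasDerivAt_neg t)).ofReal_comp).const_mul
      z).const_sub 1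
  exact hderiv.clog_real (.inl (re_one_sub_mul_exp_neg_pos h hz ht))

lemma mellin_polylogKernel_one (h : ‖z‖ ≤ 1) (hz : z ≠ 1) :
    mellin (polylogKernel z) 1 = -log (1 - z) := by
  have hint : IntegrableOn (polylogKernel z) (Set.Ioi 0) := by
    simpa [MellinConvergent] using mellinConvergent_of_isBigO_rpow_exp one_pos
      (locallyIntegrableOn_polylogKernel h hz) (polylogKernel_isBigO_atTop z)
      (polylogKernel_isBigO_zero h hz) (s := 1) (by simp)
  have hlim : Tendsto (fun t : ℝ ↦ log (1 - z * (Real.exp (-t) : ℂ))) atTop (𝓝 0) :=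
    log_one ▸ (continuousAt_clog one_mem_slitPlane).tendsto.comp (tendsto_one_sub_mul_exp_neg z)
  have hftc := integral_Ioi_of_hasDerivAt_of_tendsto
    (hasDerivAt_log_one_sub_mul_exp_neg h hz le_rfl).continuousAt.continuousWithinAt
    (fun t ht ↦ hasDerivAt_log_one_sub_mul_exp_neg h hz (le_of_lt ht)) hint hlim
  simpa [mellin] using hftc

lemma continuousAt_mellin_polylogKernel_one (h : ‖z‖ ≤ 1) (hz : z ≠ 1) :
    ContinuousAt (mellin (polylogKernel z)) 1 :=
  (mellin_differentiableAt_of_isBigO_rpow_exp one_pos (locallyIntegrableOn_polylogKernel h hz)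
    (polylogKernel_isBigO_atTop z) (polylogKernel_isBigO_zero h hz) (s := 1)
    (by simp)).continuousAt

lemma hasSum_mellin_polylogKernel (h : ‖z‖ ≤ 1) {s : ℂ} (hs : 1 < s.re) :
    HasSum (fun n : ℕ ↦ Complex.Gamma s * z ^ (n + 1) / ((n + 1 : ℕ) : ℂ) ^ s)
      (mellin (polylogKernel z) s) := by
  have hmellin := hasSum_mellin (a := fun n : ℕ ↦ z ^ (n + 1))
    (p := fun n : ℕ ↦ ((n + 1 : ℕ) : ℝ)) (F := polylogKernel z) (s := s)
    (fun n ↦ .inr (by positivity)) (by linarith) (fun t ht ↦ ?_) ?_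
  · simpa only [ofReal_natCast] using hmellin
  · have hlt : ‖z * (Real.exp (-t) : ℂ)‖ < 1 := by
      rw [norm_mul, norm_real, Real.norm_of_nonneg (Real.exp_pos _).le]
      exact mul_lt_one_of_nonneg_of_lt_one_right h (Real.exp_pos _).le
        (Real.exp_lt_one_iff.mpr (neg_lt_zero.mpr ht))
    have hgeom := (hasSum_geometric_of_norm_lt_one hlt).mul_left (z * (Real.exp (-t) : ℂ))
    rw [← div_eq_mul_inv] at hgeom
    refine hgeom.congr_fun fun n ↦ ?_
    rw [← pow_succ', mul_pow, ← ofReal_pow, ← Real.exp_nat_mul, neg_mul, mul_neg]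
  · refine .of_nonneg_of_le (fun n ↦ by positivity) (fun n ↦ ?_)
      ((summable_nat_add_iff 1).mpr (Real.summable_one_div_nat_rpow.mpr hs))
    rw [norm_pow]
    gcongr
    exact pow_le_one₀ (norm_nonneg _) h

lemma norm_e_ofReal (a : ℝ) : ‖e a‖ = 1 := by simpa using norm_e a 1

lemma e_eq_one_iff (a : ℝ) : e a = 1 ↔ (a : UnitAddCircle) = 0 := by
  rw [e, Complex.exp_eq_one_iff, AddCircle.coe_eq_zero_iff]
  refine exists_congr fun n ↦ ?_
  rw [mul_comm, mul_left_inj' (by simp [Real.pi_ne_zero]), eq_comm, zsmul_one]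
  norm_cast

lemma mellin_polylogKernel_eq_Gamma_mul_expZeta (a : ℝ) {s : ℂ} (hs : 1 < s.re) :
    mellin (polylogKernel (e a)) s = Complex.Gamma s * HurwitzZeta.expZeta a s := by
  have hsum := (HurwitzZeta.hasSum_expZeta_of_one_lt_re a hs).mul_left (Complex.Gamma s)
  have hs0 : s ≠ 0 := by rintro rfl; norm_num at hs
  rw [← hasSum_nat_add_iff' 1, Finset.sum_range_one, Nat.cast_zero, zero_cpow hs0, div_zero,
    mul_zero, sub_zero] at hsum
  refine (hasSum_mellin_polylogKernel (norm_e_ofReal a).le hs).unique (hsum.congr_fun fun n ↦ ?_)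
  rw [← e_nat_mul, e, mul_div_assoc, mul_left_comm, mul_comm ((n + 1 : ℕ) : ℂ)]

lemma expZeta_one {a : ℝ} (ha : (a : UnitAddCircle) ≠ 0) :
    HurwitzZeta.expZeta a 1 = -log (1 - e a) := by
  have hz : e a ≠ 1 := (e_eq_one_iff a).not.mpr ha
  have hcont : ContinuousAt (fun s ↦ Complex.Gamma s * HurwitzZeta.expZeta a s) 1 :=
    (differentiableAt_Gamma_one.mul
      (HurwitzZeta.differentiable_expZeta_of_ne_zero ha 1)).continuousAt
  have : (𝓝[{s : ℂ | 1 < s.re}] 1).NeBot := by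
    rw [← mem_closure_iff_nhdsWithin_neBot, Complex.closure_setOfPred_lt_re]
    exact one_re.ge
  have heq : mellin (polylogKernel (e a)) =ᶠ[𝓝[{s : ℂ | 1 < s.re}] 1]
      fun s ↦ Complex.Gamma s * HurwitzZeta.expZeta a s :=
    eventually_mem_nhdsWithin.mono fun _ ↦ mellin_polylogKernel_eq_Gamma_mul_expZeta a
  have hone := tendsto_nhds_unique_of_eventuallyEq
    ((continuousAt_mellin_polylogKernel_one (norm_e_ofReal a).le hz).mono_left nhdsWithin_le_nhds)
    (hcont.tendsto.mono_left nhdsWithin_le_nhds) heq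
  rwa [mellin_polylogKernel_one (norm_e_ofReal a).le hz, Gamma_one, one_mul, eq_comm] at hone

lemma cosZeta_one {a : ℝ} (ha : (a : UnitAddCircle) ≠ 0) :
    HurwitzZeta.cosZeta a 1 = -Real.log ‖1 - e a‖ := by
  have hconj : 1 - e (-a : ℝ) = (starRingEnd ℂ) (1 - e a) := by
    rw [ofReal_neg, e_neg, Complex.inv_eq_conj (norm_e_ofReal a), map_sub, map_one]
  have hre : 0 < (1 - e a).re := by
    simpa using re_lt_one_of_norm_le_one (norm_e_ofReal a).le ((e_eq_one_iff a).not.mpr ha)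
  have harg : (1 - e a).arg ≠ Real.pi := fun h ↦ hre.not_gt (arg_eq_pi_iff.mp h).1
  rw [HurwitzZeta.cosZeta_eq, ← AddCircle.coe_neg, expZeta_one ha,
    expZeta_one (by rwa [AddCircle.coe_neg, neg_ne_zero]), hconj, log_conj _ harg, ← neg_add,
    add_conj, log_re]
  push_cast
  ring

end Polylogarithm

/-- `log |1 - ζ_N^a|`, with the junk value `0` at `a = 0`. -/
def logCyc {N : ℕ} [NeZero N] (a : ZMod N) : ℝ := Real.log ‖1 - ZMod.stdAddChar a‖

section Characters

open DirichletCharacter ZMod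

lemma even_inv {N : ℕ} {χ : DirichletCharacter ℂ N} (hχ : χ.Even) : χ⁻¹.Even := by
  rw [DirichletCharacter.Even, MulChar.inv_apply_eq_inv, hχ, Ring.inverse_one]

variable {N : ℕ} [NeZero N]

lemma stdAddChar_eq_e (a : ZMod N) : stdAddChar a = e (a.val / N : ℝ) := by
  conv_lhs => rw [← natCast_zmod_val a, ← Int.cast_natCast, stdAddChar_coe]
  rw [e, mul_div_assoc]
  push_cast
  rfl

lemma cosZeta_toAddCircle_one {a : ZMod N} (ha : a ≠ 0) :
    HurwitzZeta.cosZeta (toAddCircle a) 1 = -logCyc a := by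
  have ha' : ((a.val / N : ℝ) : UnitAddCircle) ≠ 0 := by
    rwa [← toAddCircle_apply, ne_eq, toAddCircle_eq_zero]
  rw [toAddCircle_apply, cosZeta_one ha', logCyc, stdAddChar_eq_e]

lemma logCyc_neg (a : ZMod N) : logCyc (-a) = logCyc a := by
  rcases eq_or_ne a 0 with rfl | ha
  · rw [neg_zero]
  have h := cosZeta_toAddCircle_one (neg_ne_zero.mpr ha)
  rw [map_neg, HurwitzZeta.cosZeta_neg, cosZeta_toAddCircle_one ha, neg_inj] at h
  exact_mod_cast h.symm

lemma LFunction_dft_one_of_even {Φ : ZMod N → ℂ} (h0 : Φ 0 = 0) (heven : Φ.Even) :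
    LFunction (dft Φ) 1 = -∑ a, Φ a * logCyc a := by
  have hsymm : ∑ a, Φ a * HurwitzZeta.expZeta (-toAddCircle a) 1 =
      ∑ a, Φ a * HurwitzZeta.expZeta (toAddCircle a) 1 := by
    rw [← Equiv.sum_comp (Equiv.neg (ZMod N))]
    simp only [Equiv.neg_apply, map_neg, neg_neg, heven _]
  calc LFunction (dft Φ) 1
      = ∑ a, Φ a * HurwitzZeta.expZeta (-toAddCircle a) 1 := by
        simp only [LFunction_dft Φ (.inl h0), map_neg]
    _ = ∑ a, Φ a * HurwitzZeta.cosZeta (toAddCircle a) 1 := by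
        simp only [HurwitzZeta.cosZeta_eq, mul_div_assoc', mul_add, add_div, Finset.sum_add_distrib,
          ← Finset.sum_div]
        rw [hsymm, add_halves]
    _ = -∑ a, Φ a * logCyc a := by
        rw [← Finset.sum_neg_distrib]
        refine Finset.sum_congr rfl fun a _ ↦ ?_
        rcases eq_or_ne a 0 with rfl | ha
        · simp only [h0, zero_mul, neg_zero]
        · rw [cosZeta_toAddCircle_one ha, mul_neg]

lemma LFunction_const_mul (c : ℂ) (Φ : ZMod N → ℂ) (s : ℂ) :
    ZMod.LFunction (fun a ↦ c * Φ a) s = c * ZMod.LFunction Φ s := by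
  simp only [ZMod.LFunction, mul_assoc, ← Finset.mul_sum]
  ring

lemma gaussSum_stdAddChar_ne_zero {χ : DirichletCharacter ℂ N} (hχ : χ.IsPrimitive) :
    gaussSum χ stdAddChar ≠ 0 := by
  intro h
  have hdft : dft (χ : ZMod N → ℂ) = 0 := by
    funext k
    rw [hχ.fourierTransform_eq_inv_mul_gaussSum, h, mul_zero, Pi.zero_apply]
  have hone := congrFun ((LinearEquiv.map_eq_zero_iff _).mp hdft) 1
  rw [map_one] at hone
  exact one_ne_zero hone

lemma sum_char_mul_logCyc_ne_zero {χ : DirichletCharacter ℂ N} (hprim : χ.IsPrimitive)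
    (hχ : χ ≠ 1) (heven : χ.Even) : ∑ a, χ a * (logCyc a : ℂ) ≠ 0 := by
  have hdft : dft (χ : ZMod N → ℂ) = fun k ↦ gaussSum χ stdAddChar * χ⁻¹ k := by
    funext k
    rw [hprim.fourierTransform_eq_inv_mul_gaussSum, (even_inv heven).eval_neg, mul_comm]
  have hN : N ≠ 1 := fun h ↦ hχ (level_one' χ h)
  have hL := LFunction_dft_one_of_even (χ.map_zero' hN) heven.eval_neg
  rw [hdft, LFunction_const_mul] at hL
  exact neg_ne_zero.mp (hL ▸ mul_ne_zero (gaussSum_stdAddChar_ne_zero hprim)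
    (LFunction_apply_one_ne_zero (inv_ne_one.mpr hχ)))

lemma eq_zero_of_forall_sum_mul_char_eq_zero {f : ZMod N → ℂ}
    (h : ∀ χ : DirichletCharacter ℂ N, ∑ a, f a * χ a = 0) {b : ZMod N} (hb : IsUnit b) :
    f b = 0 := by
  have hinv : (N.totient : ℂ) * f b = ∑ χ : DirichletCharacter ℂ N, χ b⁻¹ * ∑ a, f a * χ a := by
    simp only [Finset.mul_sum]
    rw [Finset.sum_comm]
    simp only [mul_left_comm _ (f _), ← Finset.mul_sum, sum_char_inv_mul_char_eq ℂ hb, mul_ite,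
      mul_zero, Finset.sum_ite_eq, Finset.mem_univ, if_true]
    rw [mul_comm]
  simp only [h, mul_zero, Finset.sum_const_zero] at hinv
  exact (mul_eq_zero.mp hinv).resolve_left
    (Nat.cast_ne_zero.mpr (Nat.totient_pos.mpr (NeZero.pos N)).ne')

lemma sum_mul_char_eq_zero_of_odd {f : ZMod N → ℂ} (hf : f.Even) {χ : DirichletCharacter ℂ N}
    (hχ : χ.Odd) : ∑ a, f a * χ a = 0 := by
  have h := Equiv.sum_comp (Equiv.neg (ZMod N)) fun a ↦ f a * χ a
  simp only [Equiv.neg_apply, hf _, hχ.eval_neg, mul_neg, Finset.sum_neg_distrib] at h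
  exact self_eq_neg.mp h.symm

variable {p : ℕ} [Fact p.Prime]

lemma sum_char_mul_sum_mul_comp_mul (χ : DirichletCharacter ℂ p) {f : ZMod p → ℂ} (h0 : f 0 = 0)
    (g : ZMod p → ℂ) :
    ∑ b, χ b * ∑ a, f a * g (a * b) = (∑ a, f a * χ⁻¹ a) * ∑ c, χ c * g c := by
  simp only [Finset.mul_sum (s := .univ) (f := fun a ↦ f a * g _)]
  rw [Finset.sum_comm, Finset.sum_mul]
  refine Finset.sum_congr rfl fun a _ ↦ ?_
  rcases eq_or_ne a 0 with rfl | ha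
  · simp only [h0, zero_mul, mul_zero, Finset.sum_const_zero]
  have hχ : χ⁻¹ a * χ a = 1 := by
    rw [← MulChar.mul_apply, inv_mul_cancel, MulChar.one_apply (isUnit_iff_ne_zero.mpr ha)]
  rw [← Equiv.sum_comp (Equiv.mulLeft₀ a ha) fun c ↦ χ c * g c, Finset.mul_sum]
  refine Finset.sum_congr rfl fun b _ ↦ ?_
  rw [Equiv.mulLeft₀_apply, map_mul]
  linear_combination (-f a * χ b * g (a * b)) * hχ

lemma isPrimitive_of_ne_one {χ : DirichletCharacter ℂ p} (hχ : χ ≠ 1) : χ.IsPrimitive :=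
  ((Nat.dvd_prime Fact.out).mp χ.conductor_dvd_level).resolve_left
    (χ.eq_one_iff_conductor_eq_one.not.mp hχ)

lemma eq_zero_of_sum_mul_logCyc_eq_zero {f : ZMod p → ℂ} (heven : f.Even) (h0 : f 0 = 0)
    (hsum : ∑ a, f a = 0) (h : ∀ b ≠ 0, ∑ a, f a * logCyc (a * b) = 0) : f = 0 := by
  have hall (χ : DirichletCharacter ℂ p) : ∑ a, f a * χ a = 0 := by
    rcases χ.even_or_odd with hχ | hχ
    · rcases eq_or_ne χ 1 with rfl | hχ1
      · rw [← hsum]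
        refine Finset.sum_congr rfl fun a _ ↦ ?_
        rcases eq_or_ne a 0 with rfl | ha
        · rw [h0, zero_mul]
        · rw [MulChar.one_apply (isUnit_iff_ne_zero.mpr ha), mul_one]
      have hprod := sum_char_mul_sum_mul_comp_mul χ⁻¹ h0 fun a ↦ logCyc a
      rw [Finset.sum_eq_zero, inv_inv, eq_comm, mul_eq_zero] at hprod
      · exact hprod.resolve_right (sum_char_mul_logCyc_ne_zero
          (isPrimitive_of_ne_one (inv_ne_one.mpr hχ1)) (inv_ne_one.mpr hχ1) (even_inv hχ))
      · intro b _
        rcases eq_or_ne b 0 with rfl | hb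
        · rw [χ⁻¹.map_zero' (Fact.out : p.Prime).ne_one, zero_mul]
        · rw [h b hb, mul_zero]
    · exact sum_mul_char_eq_zero_of_odd heven hχ
  funext b
  rcases eq_or_ne b 0 with rfl | hb
  · exact h0
  · exact eq_zero_of_forall_sum_mul_char_eq_zero hall (isUnit_iff_ne_zero.mpr hb)

lemma odd_of_sum_mul_logCyc_eq_zero {D : ZMod p → ℤ} (h0 : D 0 = 0) (hsum : ∑ a, D a = 0)
    (h : ∀ b ≠ 0, ∑ a, (D a : ℝ) * logCyc (a * b) = 0) : D.Odd := by
  have hneg {M : Type} [AddCommMonoid M] (φ : ZMod p → M) : ∑ a, φ (-a) = ∑ a, φ a :=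
    Equiv.sum_comp (Equiv.neg (ZMod p)) φ
  have hzero := eq_zero_of_sum_mul_logCyc_eq_zero (f := fun a ↦ ((D a + D (-a) : ℤ) : ℂ))
    (fun a ↦ by simp only [neg_neg, add_comm]) (by simp [h0])
    (by rw [← Int.cast_sum, Finset.sum_add_distrib, hneg, hsum, add_zero, Int.cast_zero])
    fun b hb ↦ by
      have hnegb := hneg fun a ↦ (D a : ℝ) * logCyc (a * b)
      simp only [neg_mul, logCyc_neg] at hnegb
      have := h b hb
      simp only [Int.cast_add, add_mul, Finset.sum_add_distrib]
      exact_mod_cast (by rw [hnegb, this, add_zero])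
  intro a
  have : D a + D (-a) = 0 := Int.cast_eq_zero.mp (congrFun hzero a)
  omega

end Characters

/-- The factor `ζ_ℓ^{-j/2} (1 - ζ_ℓ^{2j}) / (1 - ζ_ℓ^j)` of `cuspValue`. -/
def cuspFactor (ℓ j : ℕ) : ℂ :=
  e (-(j / (2 * ℓ))) * ((1 - zeta ℓ ^ (2 * j)) / (1 - zeta ℓ ^ j))

section CuspValues

lemma isIntegral_one_sub_pow_div {K : Type*} [Field K] {z : K} (hz : IsIntegral ℤ z) (n : ℕ) :
    IsIntegral ℤ ((1 - z ^ n) / (1 - z)) := by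
  rcases eq_or_ne (1 - z) 0 with h0 | h0
  · rw [h0, div_zero]
    exact isIntegral_zero
  · rw [← mul_neg_geom_sum, mul_div_cancel_left₀ _ h0]
    exact .sum _ fun i _ ↦ hz.pow i

lemma mem_range_units_of_isIntegral {F : IntermediateField ℚ ℂ} {u : ℂˣ} (hu : (u : ℂ) ∈ F)
    (h : IsIntegral ℤ (u : ℂ)) (h' : IsIntegral ℤ (u : ℂ)⁻¹) :
    u ∈ (Units.map (algebraMap (𝓞 F) ℂ).toMonoidHom).range := by
  have hint {x : ℂ} (hx : x ∈ F) (hi : IsIntegral ℤ x) : IsIntegral ℤ (⟨x, hx⟩ : F) :=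
    (isIntegral_algHom_iff (F.val.restrictScalars ℤ) F.val.injective).mp hi
  let a : 𝓞 F := ⟨⟨u, hu⟩, hint hu h⟩
  let b : 𝓞 F := ⟨⟨(u : ℂ)⁻¹, inv_mem hu⟩, hint (inv_mem hu) h'⟩
  have hab : a * b = 1 := RingOfIntegers.ext (Subtype.ext (mul_inv_cancel₀ u.ne_zero))
  exact ⟨⟨a, b, hab, mul_comm b a ▸ hab⟩, Units.ext rfl⟩

variable {ℓ k j m : ℕ}

lemma one_sub_zeta_pow_ne_zero (h0 : 0 < j) (hj : j < ℓ) : 1 - zeta ℓ ^ j ≠ 0 :=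
  sub_ne_zero.mpr ((zeta_isPrimitiveRoot (by omega)).pow_ne_one_of_pos_of_lt h0.ne' hj).symm

lemma cuspFactor_ne_zero (h0 : 0 < j) (hj : 2 * j < ℓ) : cuspFactor ℓ j ≠ 0 :=
  mul_ne_zero (e_ne_zero _) (div_ne_zero (one_sub_zeta_pow_ne_zero (by omega) hj)
    (one_sub_zeta_pow_ne_zero h0 (by omega)))

lemma cuspFactor_eq (h0 : 0 < j) (hj : j < ℓ) :
    cuspFactor ℓ j = e (-(j / (2 * ℓ))) * (1 + zeta ℓ ^ j) := by
  rw [cuspFactor, mul_comm 2 j, pow_mul, ← one_pow 2, sq_sub_sq, one_pow,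
    mul_div_cancel_right₀ _ (one_sub_zeta_pow_ne_zero h0 hj)]

lemma cuspFactor_eq_two_mul_cos (h0 : 0 < j) (hj : j < ℓ) :
    cuspFactor ℓ j = (2 * Real.cos (Real.pi * j / ℓ) : ℝ) := by
  have hℓ : (ℓ : ℂ) ≠ 0 := Nat.cast_ne_zero.mpr (by omega)
  rw [cuspFactor_eq h0 hj, zeta_pow, mul_add, mul_one, ← e_add]
  push_cast
  rw [Complex.two_cos, add_comm, e, e]
  congr 2
  · field_simp
    ring
  · field_simp

lemma e_neg_div_two_mul (h : ℓ = 2 * k + 1) (j : ℕ) :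
    e (-(j / (2 * ℓ))) = (-zeta ℓ ^ k) ^ j := by
  have hℓ : (ℓ : ℂ) ≠ 0 := Nat.cast_ne_zero.mpr (by omega)
  have hodd : (ℓ : ℂ) = 2 * k + 1 := mod_cast h
  have hroot : e (-(1 / (2 * ℓ))) = -zeta ℓ ^ k := by
    have hexp : (-(1 / (2 * ℓ)) + 1 : ℂ) = 1 / 2 + k / ℓ := by
      field_simp
      rw [hodd]
      ring
    rw [zeta_pow, ← neg_one_mul (e _), ← e_half, ← e_add, ← hexp, e_add, e_one, mul_one]
  rw [← hroot, ← e_nat_mul]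
  congr 1
  field_simp

lemma cuspFactor_mem_cyclotomicRealField (h : ℓ = 2 * k + 1) (h0 : 0 < j) (hj : j < ℓ) :
    cuspFactor ℓ j ∈ cyclotomicRealField ℓ := by
  refine ⟨?_, IntermediateField.mem_bot.mpr ⟨_, (cuspFactor_eq_two_mul_cos h0 hj).symm⟩⟩
  have hz := IntermediateField.mem_adjoin_simple_self ℚ (zeta ℓ)
  rw [cuspFactor_eq h0 hj, e_neg_div_two_mul h]
  exact mul_mem (pow_mem (neg_mem (pow_mem hz _)) _) (add_mem (one_mem _) (pow_mem hz _))

lemma isIntegral_cuspFactor (h : ℓ = 2 * k + 1) (j : ℕ) : IsIntegral ℤ (cuspFactor ℓ j) := by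
  have hz : IsIntegral ℤ (zeta ℓ) := (zeta_isPrimitiveRoot (by omega)).isIntegral (by omega)
  rw [cuspFactor, e_neg_div_two_mul h, mul_comm 2 j, pow_mul]
  exact ((hz.pow k).neg.pow j).mul (isIntegral_one_sub_pow_div (hz.pow j) 2)

lemma isIntegral_inv_cuspFactor (h : ℓ = 2 * k + 1) (j : ℕ) :
    IsIntegral ℤ (cuspFactor ℓ j)⁻¹ := by
  have hroot := zeta_isPrimitiveRoot (show ℓ ≠ 0 by omega)
  have hz : IsIntegral ℤ (zeta ℓ) := hroot.isIntegral (by omega)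
  have hz' : IsIntegral ℤ (zeta ℓ)⁻¹ := hroot.inv.isIntegral (by omega)
  -- `2` is invertible modulo `ℓ`, with inverse `k + 1`
  have hpow : zeta ℓ ^ j = (zeta ℓ ^ (2 * j)) ^ (k + 1) := by
    rw [← pow_mul, show 2 * j * (k + 1) = ℓ * j + j by rw [h]; ring, pow_add, pow_mul,
      hroot.pow_eq_one, one_pow, one_mul]
  rw [cuspFactor, e_neg_div_two_mul h, mul_inv, inv_div, ← inv_pow, inv_neg, ← inv_pow, hpow]
  exact ((hz'.pow k).neg.pow j).mul (isIntegral_one_sub_pow_div (hz.pow _) _)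

lemma cuspFactor_mem_cyclotomicUnits (h : ℓ = 2 * k + 1) (h0 : 0 < j) (hj : 2 * j < ℓ) :
    Units.mk0 (cuspFactor ℓ j) (cuspFactor_ne_zero h0 hj) ∈ cyclotomicUnits ℓ := by
  refine Subgroup.mem_inf.mpr ⟨?_, mem_range_units_of_isIntegral
    (cuspFactor_mem_cyclotomicRealField h h0 (by omega)) (isIntegral_cuspFactor h j)
    (isIntegral_inv_cuspFactor h j)⟩
  let z := Units.mk0 (zeta ℓ) (e_ne_zero _)
  let w (a : ℕ) (ha0 : 0 < a) (ha : a < ℓ) := Units.mk0 _ (one_sub_zeta_pow_ne_zero ha0 ha)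
  have hfactor : Units.mk0 (cuspFactor ℓ j) (cuspFactor_ne_zero h0 hj) =
      (-z / z * z ^ k) ^ j * (w (2 * j) (by omega) hj / w j h0 (by omega)) := by
    refine Units.ext ?_
    rw [neg_div, div_self', neg_one_mul, Units.val_mk0, cuspFactor, e_neg_div_two_mul h]
    rfl
  rw [hfactor]
  refine mul_mem (pow_mem (mul_mem (div_mem ?_ ?_) (pow_mem ?_ _)) _) (div_mem ?_ ?_) <;>
    refine Subgroup.subset_closure ?_
  · exact .inr (.inl rfl)
  · exact .inl rfl
  · exact .inl rfl
  · exact .inr (.inr ⟨2 * j, by omega, hj, rfl⟩)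
  · exact .inr (.inr ⟨j, h0, by omega, rfl⟩)

lemma exists_mem_cyclotomicUnits_eq_cuspValue (h : ℓ = 2 * k + 1) (hm : 2 * m < ℓ) :
    ∃ u ∈ cyclotomicUnits ℓ, (u : ℂ) = cuspValue ℓ m := by
  suffices cuspValue ℓ m ∈ (cyclotomicUnits ℓ).toSubmonoid.map (Units.coeHom ℂ) by
    exact this
  refine prod_mem fun j hj ↦ ?_
  obtain ⟨h0, hjm⟩ := Finset.mem_Icc.mp hj
  exact ⟨_, cuspFactor_mem_cyclotomicUnits h h0 (by omega), rfl⟩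

lemma cuspValue_ne_zero (hm : 2 * m < ℓ) : cuspValue ℓ m ≠ 0 := by
  refine Finset.prod_ne_zero_iff.mpr fun j hj ↦ ?_
  obtain ⟨h0, hjm⟩ := Finset.mem_Icc.mp hj
  exact cuspFactor_ne_zero h0 (by omega)

end CuspValues

/-- A polynomial whose value at `ζ_ℓ`, for `ℓ = 2k+1`, is `cuspValue ℓ m`: the square root of
`ζ_ℓ⁻¹` chosen in `cuspValue` is `-ζ_ℓ^k`. -/
def cuspPoly (k m : ℕ) : Polynomial ℚ :=
  ∏ j ∈ Finset.Icc 1 m, (-Polynomial.X ^ k) ^ j * (1 + Polynomial.X ^ j)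

section GaloisConjugation

open IntermediateField Polynomial ZMod

lemma prod_aeval_zpow_eq_one_of_minpoly_eq {F L ι : Type*} [Field F] [Field L] [Algebra F L]
    [Fintype ι] {α β : L} (hα : IsIntegral F α) (hβ : minpoly F α = minpoly F β) (f : ι → F[X])
    (n : ι → ℤ) (h : ∏ i, aeval α (f i) ^ n i = 1) : ∏ i, aeval β (f i) ^ n i = 1 := by
  have hroot : β ∈ (minpoly F α).aroots L :=
    mem_aroots.mpr ⟨minpoly.ne_zero hα, hβ ▸ minpoly.aeval F β⟩
  let σ := (algHomAdjoinIntegralEquiv F hα).symm ⟨β, hroot⟩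
  have hσ : σ (AdjoinSimple.gen F α) = β :=
    algHomAdjoinIntegralEquiv_symm_apply_gen F hα ⟨β, hroot⟩
  have hval : F⟮α⟯.val (AdjoinSimple.gen F α) = α :=
    AdjoinSimple.coe_gen F α
  rw [← hσ]
  rw [← hval] at h
  simp only [aeval_algHom_apply, ← map_zpow₀, ← map_prod] at h ⊢
  rw [F⟮α⟯.val.injective (h.trans (map_one _).symm), map_one]

lemma aeval_zeta_cuspPoly {ℓ k m : ℕ} (h : ℓ = 2 * k + 1) (hm : 2 * m < ℓ) :
    aeval (zeta ℓ) (cuspPoly k m) = cuspValue ℓ m := by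
  rw [cuspPoly, map_prod, cuspValue]
  refine Finset.prod_congr rfl fun j hj ↦ ?_
  obtain ⟨h0, hjm⟩ := Finset.mem_Icc.mp hj
  change _ = cuspFactor ℓ j
  rw [cuspFactor_eq h0 (by omega), e_neg_div_two_mul h]
  simp only [map_mul, map_pow, map_neg, map_add, map_one, aeval_X]

lemma natCast_ne_zero_of_pos_of_lt {N j : ℕ} (h0 : 0 < j) (hj : j < N) : (j : ZMod N) ≠ 0 :=
  (natCast_eq_zero_iff j N).not.mpr (Nat.not_dvd_of_pos_of_lt h0 hj)

lemma two_mul_natCast_ne_zero {N j : ℕ} (h0 : 0 < j) (hj : 2 * j < N) : (2 * j : ZMod N) ≠ 0 :=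
  mod_cast natCast_ne_zero_of_pos_of_lt (by omega : 0 < 2 * j) hj

lemma stdAddChar_natCast_mul {N : ℕ} [NeZero N] (n : ℕ) (a : ZMod N) :
    stdAddChar ((n : ZMod N) * a) = stdAddChar a ^ n := by
  rw [← nsmul_eq_mul, AddChar.map_nsmul_eq_pow]

lemma stdAddChar_eq_one_iff {N : ℕ} [NeZero N] {a : ZMod N} : stdAddChar a = 1 ↔ a = 0 := by
  rw [← AddChar.map_zero_eq_one (stdAddChar (N := N)), injective_stdAddChar.eq_iff]

lemma isPrimitiveRoot_stdAddChar {N : ℕ} [NeZero N] {b : ZMod N} (hb : IsUnit b) :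
    IsPrimitiveRoot (stdAddChar b) N := by
  have hiff (n : ℕ) : stdAddChar b ^ n = 1 ↔ N ∣ n := by
    rw [← stdAddChar_natCast_mul, stdAddChar_eq_one_iff, hb.mul_left_eq_zero, natCast_eq_zero_iff]
  exact ⟨(hiff N).mpr dvd_rfl, fun n ↦ (hiff n).mp⟩

lemma one_add_stdAddChar_ne_zero {N : ℕ} [NeZero N] {a : ZMod N} (ha : 2 * a ≠ 0) :
    1 + stdAddChar a ≠ 0 := by
  refine fun h ↦ ha (stdAddChar_eq_one_iff.mp ?_)
  rw [two_mul, AddChar.map_add_eq_mul, eq_neg_of_add_eq_zero_right h, neg_one_mul, neg_neg]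

lemma log_norm_one_add_stdAddChar {N : ℕ} [NeZero N] {a : ZMod N} (ha : 2 * a ≠ 0) :
    Real.log ‖1 + stdAddChar a‖ = logCyc (2 * a) - logCyc a := by
  have hfactor : 1 - stdAddChar (2 * a) = (1 - stdAddChar a) * (1 + stdAddChar a) := by
    rw [two_mul, AddChar.map_add_eq_mul]
    ring
  have ha' : 1 - stdAddChar a ≠ 0 :=
    sub_ne_zero.mpr (Ne.symm (stdAddChar_eq_one_iff.not.mpr (right_ne_zero_of_mul ha)))
  rw [logCyc, hfactor, norm_mul, Real.log_mul (norm_ne_zero_iff.mpr ha')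
    (norm_ne_zero_iff.mpr (one_add_stdAddChar_ne_zero ha)), logCyc, add_sub_cancel_left]

end GaloisConjugation

/-- The divisor `∑_i n_i ∑_{1 ≤ j ≤ m_i} ([2j] - [j])` on `ℤ/N`, recording the exponents in the
product `∏_i s_{N,m_i} ^ n_i` of the Siegel functions indexed by `ℤ/N`. -/
def doublingDivisor {ι : Type*} [Fintype ι] (N : ℕ) (m : ι → ℕ) (n : ι → ℤ) : ZMod N →₀ ℤ :=
  ∑ i, n i • ∑ j ∈ Finset.Icc 1 (m i),
    (Finsupp.single (2 * j : ZMod N) 1 - Finsupp.single (j : ZMod N) 1)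

section Relations

open ZMod

lemma sum_smul_eq_zero_of_odd_of_even {G M : Type*} [Fintype G] [InvolutiveNeg G]
    [AddCommGroup M] {D : G → ℤ} (hD : D.Odd) {φ : G → M} (hφ : φ.Even) : ∑ a, D a • φ a = 0 := by
  refine Finset.sum_involution (fun a _ ↦ -a) (fun a _ ↦ ?_) (fun a _ ha h ↦ ha ?_)
    (fun a _ ↦ Finset.mem_univ _) (fun a _ ↦ neg_neg a)
  · rw [hD, hφ, neg_zsmul, add_neg_cancel]
  · rw [self_eq_neg.mp ((congrArg D h).symm.trans (hD a)), zero_zsmul]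

variable {ι : Type*} [Fintype ι] {N : ℕ} [NeZero N] {m : ι → ℕ}

lemma sum_doublingDivisor_smul {M : Type*} [AddCommGroup M] (φ : ZMod N → M) (m : ι → ℕ)
    (n : ι → ℤ) :
    ∑ a, doublingDivisor N m n a • φ a =
      ∑ i, n i • ∑ j ∈ Finset.Icc 1 (m i), (φ (2 * j) - φ j) := by
  have h := Finsupp.linearCombination_apply ℤ (v := φ) (doublingDivisor N m n)
  rw [Finsupp.sum_fintype _ _ fun _ ↦ zero_zsmul _] at h
  rw [← h, doublingDivisor]
  simp only [map_sum, _root_.map_smul, map_sub, Finsupp.linearCombination_single, one_smul]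

lemma sum_doublingDivisor (m : ι → ℕ) (n : ι → ℤ) : ∑ a, doublingDivisor N m n a = 0 := by
  simpa using sum_doublingDivisor_smul (N := N) (fun _ ↦ (1 : ℤ)) m n

lemma doublingDivisor_zero (hm : ∀ i, 2 * m i < N) (n : ι → ℤ) : doublingDivisor N m n 0 = 0 := by
  have h := sum_doublingDivisor_smul (N := N) (Pi.single 0 (1 : ℤ)) m n
  rw [Finset.sum_eq_zero (s := .univ) (f := fun i ↦ n i • _)] at h
  · simpa [Pi.single_apply] using h
  · refine fun i _ ↦ smul_eq_zero_of_right _ (Finset.sum_eq_zero fun j hj ↦ ?_)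
    obtain ⟨h0, hjm⟩ := Finset.mem_Icc.mp hj
    have hmi := hm i
    rw [Pi.single_eq_of_ne (two_mul_natCast_ne_zero h0 (by omega)),
      Pi.single_eq_of_ne (natCast_ne_zero_of_pos_of_lt h0 (by omega)), sub_zero]

lemma siegel_one_sub {a : ℝ} (h0 : 0 < a) (h1 : a < 1) (τ : ℂ) :
    siegel (1 - a) 0 τ = siegel a 0 τ := by
  rw [siegel, siegel, bernoulliTwo_of_mem_Ico ⟨h0.le, h1⟩,
    bernoulliTwo_of_mem_Ico ⟨by linarith, by linarith⟩]
  congr 1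
  · simp only [ofReal_zero, zero_mul, zero_div]
    congr 4
    ring_nf
  · refine tprod_congr fun n ↦ ?_
    simp only [ofReal_zero, neg_zero, e_zero, mul_one, ofReal_sub, ofReal_one]
    rw [mul_comm]
    congr 4 <;> ring_nf

lemma val_div_mem_Ioo {a : ZMod N} (ha : a ≠ 0) : (a.val / N : ℝ) ∈ Set.Ioo 0 1 := by
  have hN : (0 : ℝ) < N := mod_cast NeZero.pos N
  exact ⟨div_pos (mod_cast val_pos.mpr ha) hN, (div_lt_one hN).mpr (mod_cast val_lt a)⟩

lemma siegel_val_div_ne_zero {a : ZMod N} (ha : a ≠ 0) (τ : ℍ) :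
    siegel (a.val / N) 0 (N * (τ : ℂ)) ≠ 0 :=
  siegel_ne_zero (val_div_mem_Ioo ha).1 (val_div_mem_Ioo ha).2
    (by simpa using mul_pos (Nat.cast_pos.mpr (NeZero.pos N)) τ.im_pos)

/-- The Siegel function `τ ↦ g_(a/N,0)(Nτ)` of a nonzero residue class `a` modulo `N`, as a
nowhere vanishing function on `ℍ`; by convention `1` for `a = 0`. -/
def siegelUnit (a : ZMod N) : (ℍ → ℂ)ˣ :=
  if ha : a = 0 then 1 else
    { val := fun τ ↦ siegel (a.val / N) 0 (N * (τ : ℂ))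
      inv := fun τ ↦ (siegel (a.val / N) 0 (N * (τ : ℂ)))⁻¹
      val_inv := funext fun τ ↦ mul_inv_cancel₀ (siegel_val_div_ne_zero ha τ)
      inv_val := funext fun τ ↦ inv_mul_cancel₀ (siegel_val_div_ne_zero ha τ) }

lemma siegelUnit_apply {a : ZMod N} (ha : a ≠ 0) (τ : ℍ) :
    (siegelUnit a : ℍ → ℂ) τ = siegel (a.val / N) 0 (N * (τ : ℂ)) := by
  rw [siegelUnit, dif_neg ha]

lemma siegelUnit_even : (siegelUnit (N := N)).Even := by
  intro a
  rcases eq_or_ne a 0 with rfl | ha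
  · rw [neg_zero]
  have : NeZero a := ⟨ha⟩
  refine Units.ext (funext fun τ ↦ ?_)
  rw [siegelUnit_apply ha, siegelUnit_apply (neg_ne_zero.mpr ha), val_neg_of_ne_zero,
    Nat.cast_sub (val_lt a).le, sub_div, div_self (NeZero.ne _),
    siegel_one_sub (val_div_mem_Ioo ha).1 (val_div_mem_Ioo ha).2]

lemma siegelUnit_natCast_apply {j : ℕ} (h0 : 0 < j) (hj : j < N) (τ : ℍ) :
    (siegelUnit (j : ZMod N) : ℍ → ℂ) τ = siegel (j / N) 0 (N * (τ : ℂ)) := by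
  rw [siegelUnit_apply (natCast_ne_zero_of_pos_of_lt h0 hj), val_natCast_of_lt hj]

lemma sUnit_eq_prod_siegelUnit {m : ℕ} (hm : 2 * m < N) :
    sUnit N m hm =
      ∏ j ∈ Finset.Icc 1 m, siegelUnit (2 * j : ZMod N) / siegelUnit (j : ZMod N) := by
  refine Units.ext (funext fun τ ↦ ?_)
  change sFun N m τ = _
  rw [sFun, Units.coe_prod, Finset.prod_apply]
  refine Finset.prod_congr rfl fun j hj ↦ ?_
  obtain ⟨h0, hjm⟩ := Finset.mem_Icc.mp hj
  have hdouble : (2 * j : ZMod N) = (2 * j : ℕ) := by push_cast; rfl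
  rw [Units.val_div_eq_div_val, Pi.div_apply, hdouble,
    siegelUnit_natCast_apply (by omega) (by omega), siegelUnit_natCast_apply h0 (by omega)]
  push_cast
  rfl

lemma prod_sUnit_zpow_eq_one_of_odd (hm : ∀ i, 2 * m i < N) {n : ι → ℤ}
    (hD : (doublingDivisor N m n : ZMod N → ℤ).Odd) : ∏ i, sUnit N (m i) (hm i) ^ n i = 1 := by
  have heven : (fun a : ZMod N ↦ Additive.ofMul (siegelUnit a)).Even :=
    fun a ↦ congrArg Additive.ofMul (siegelUnit_even a)
  have h := sum_smul_eq_zero_of_odd_of_even hD heven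
  rw [sum_doublingDivisor_smul] at h
  simp only [sUnit_eq_prod_siegelUnit]
  simpa only [toMul_sum, toMul_zsmul, toMul_sub, toMul_ofMul, toMul_zero] using
    congrArg Additive.toMul h

lemma log_norm_aeval_cuspPoly {k m : ℕ} {b : ZMod N} (hb : IsUnit b) (hm : 2 * m < N) :
    Real.log ‖Polynomial.aeval (stdAddChar b) (cuspPoly k m)‖ =
      ∑ j ∈ Finset.Icc 1 m, (logCyc (N := N) (2 * j * b) - logCyc (N := N) (j * b)) := by
  have hne {j : ℕ} (hj : j ∈ Finset.Icc 1 m) : 2 * (j * b : ZMod N) ≠ 0 := by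
    obtain ⟨h0, hjm⟩ := Finset.mem_Icc.mp hj
    rw [← mul_assoc, ne_eq, hb.mul_left_eq_zero]
    exact two_mul_natCast_ne_zero h0 (by omega)
  have hfactor : ‖Polynomial.aeval (stdAddChar b) (cuspPoly k m)‖ =
      ∏ j ∈ Finset.Icc 1 m, ‖1 + stdAddChar (j * b : ZMod N)‖ := by
    simp only [cuspPoly, map_prod, map_mul, map_pow, map_neg, map_add, map_one,
      Polynomial.aeval_X, norm_prod, norm_mul, norm_pow, norm_neg, AddChar.norm_apply, one_pow,
      one_mul, stdAddChar_natCast_mul]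
  rw [hfactor, Real.log_prod fun j hj ↦ norm_ne_zero_iff.mpr (one_add_stdAddChar_ne_zero (hne hj))]
  refine Finset.sum_congr rfl fun j hj ↦ ?_
  rw [log_norm_one_add_stdAddChar (hne hj), mul_assoc]

/-- `cuspValue ℓ m` as a unit of `ℂ`. -/
def cuspUnit (ℓ m : ℕ) (h : 2 * m < ℓ) : ℂˣ :=
  Units.mk0 (cuspValue ℓ m) (cuspValue_ne_zero h)

lemma prod_cuspUnit_zpow_eq_one_iff {ℓ : ℕ} {m : ι → ℕ} (hm : ∀ i, 2 * m i < ℓ) {n : ι → ℤ} :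
    ∏ i, cuspUnit ℓ (m i) (hm i) ^ n i = 1 ↔ ∏ i, cuspValue ℓ (m i) ^ n i = 1 := by
  rw [Units.ext_iff]
  simp only [Units.coe_prod, Units.val_zpow_eq_zpow_val, cuspUnit, Units.val_mk0, Units.val_one]

lemma sum_doublingDivisor_mul_logCyc_eq_zero {k : ℕ} (h : N = 2 * k + 1) (hm : ∀ i, 2 * m i < N)
    {n : ι → ℤ} (hn : ∏ i, cuspValue N (m i) ^ n i = 1) {b : ZMod N} (hb : IsUnit b) :
    ∑ a, (doublingDivisor N m n a : ℝ) * logCyc (a * b) = 0 := by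
  have hminpoly : minpoly ℚ (zeta N) = minpoly ℚ (stdAddChar b) := by
    rw [← Polynomial.cyclotomic_eq_minpoly_rat (zeta_isPrimitiveRoot (NeZero.ne N)) (NeZero.pos N),
      Polynomial.cyclotomic_eq_minpoly_rat (isPrimitiveRoot_stdAddChar hb) (NeZero.pos N)]
  have hconj : ∏ i, Polynomial.aeval (stdAddChar b) (cuspPoly k (m i)) ^ n i = 1 := by
    refine prod_aeval_zpow_eq_one_of_minpoly_eq
      ((zeta_isPrimitiveRoot (NeZero.ne N)).isIntegral (NeZero.pos N)).tower_top hminpoly _ n ?_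
    simpa only [aeval_zeta_cuspPoly h (hm _)] using hn
  have hne (i : ι) : ‖Polynomial.aeval (stdAddChar b) (cuspPoly k (m i)) ^ n i‖ ≠ 0 :=
    norm_ne_zero_iff.mpr (Finset.prod_ne_zero_iff.mp (hconj ▸ one_ne_zero) i (Finset.mem_univ i))
  have hlog := congrArg (fun z : ℂ ↦ Real.log ‖z‖) hconj
  rw [norm_prod, norm_one, Real.log_one, Real.log_prod fun i _ ↦ hne i] at hlog
  simp only [norm_zpow, Real.log_zpow, log_norm_aeval_cuspPoly hb (hm _)] at hlog
  have hsum := sum_doublingDivisor_smul (fun a : ZMod N ↦ logCyc (a * b)) m n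
  simp only [zsmul_eq_mul] at hsum
  exact hsum.trans hlog

lemma prod_sUnit_zpow_eq_one_of_prod_cuspUnit {p k : ℕ} (hp : p.Prime) (h : p = 2 * k + 1)
    (hm : ∀ i, 2 * m i < p) {n : ι → ℤ} (hn : ∏ i, cuspUnit p (m i) (hm i) ^ n i = 1) :
    ∏ i, sUnit p (m i) (hm i) ^ n i = 1 := by
  have : Fact p.Prime := ⟨hp⟩
  exact prod_sUnit_zpow_eq_one_of_odd hm (odd_of_sum_mul_logCyc_eq_zero (doublingDivisor_zero hm n)
    (sum_doublingDivisor m n) fun b hb ↦ sum_doublingDivisor_mul_logCyc_eq_zero h hm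
      ((prod_cuspUnit_zpow_eq_one_iff hm).mp hn) (isUnit_iff_ne_zero.mpr hb))

instance : atCuspZero.NeBot :=
  (inferInstance : atImInfty.NeBot).comap_of_surj (MulAction.surjective ModularGroup.S)

lemma prod_cuspUnit_zpow_eq_one_of_prod_sUnit {ℓ : ℕ} (hm : ∀ i, 2 * m i < ℓ) {n : ι → ℤ}
    (hn : ∏ i, sUnit ℓ (m i) (hm i) ^ n i = 1) : ∏ i, cuspUnit ℓ (m i) (hm i) ^ n i = 1 := by
  have hone (τ : ℍ) : ∏ i, sFun ℓ (m i) τ ^ n i = 1 := by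
    have h := congrFun (congrArg Units.val hn) τ
    simp only [Units.coe_prod, Units.val_zpow_eq_zpow_val, Finset.prod_apply, Pi.pow_apply] at h
    exact h
  have hlim : Tendsto (fun τ ↦ ∏ i, sFun ℓ (m i) τ ^ n i) atCuspZero
      (𝓝 (∏ i, cuspValue ℓ (m i) ^ n i)) :=
    tendsto_finsetProd _ fun i _ ↦
      (tendsto_sFun (hm i)).zpow₀ _ (Or.inl (cuspValue_ne_zero (hm i)))
  simp only [hone] at hlim
  exact (prod_cuspUnit_zpow_eq_one_iff hm).mpr (tendsto_nhds_unique hlim tendsto_const_nhds)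

end Relations

section Rank

universe u v

variable {ι : Type*} [Fintype ι]

lemma coe_linearCombination_closure_range {C : Type*} [CommGroup C] (f : ι → C) (n : ι →₀ ℤ) :
    ((Finsupp.linearCombination ℤ fun i ↦ Additive.ofMul
      (⟨f i, Subgroup.subset_closure ⟨i, rfl⟩⟩ : Subgroup.closure (Set.range f))) n).toMul =
      ∏ i, f i ^ n i := by
  rw [Finsupp.linearCombination_apply, Finsupp.sum_fintype _ _ fun _ ↦ zero_zsmul _, toMul_sum,
    Subgroup.val_finsetProd]
  rfl

lemma exists_surjective_linearMap_closure_range {C : Type*} [CommGroup C] (f : ι → C) :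
    ∃ L : (ι →₀ ℤ) →ₗ[ℤ] Additive (Subgroup.closure (Set.range f)),
      Function.Surjective L ∧ ∀ n, L n = 0 ↔ ∏ i, f i ^ n i = 1 := by
  refine ⟨Finsupp.linearCombination ℤ fun i ↦ Additive.ofMul
    ⟨f i, Subgroup.subset_closure ⟨i, rfl⟩⟩, fun x ↦ ?_, fun n ↦ ?_⟩
  · obtain ⟨n, hn⟩ := Subgroup.exists_finsupp_of_mem_closure_range f _ x.toMul.2
    refine ⟨n, Additive.toMul.injective (Subtype.ext ?_)⟩
    rw [coe_linearCombination_closure_range, hn, Finsupp.prod_fintype _ _ fun _ ↦ zpow_zero _]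
  · rw [← coe_linearCombination_closure_range, OneMemClass.coe_eq_one, toMul_eq_one]

lemma abRank_closure_range_eq {A : Type u} {B : Type v} [CommGroup A] [CommGroup B] (f : ι → A)
    (g : ι → B) (h : ∀ n : ι → ℤ, ∏ i, f i ^ n i = 1 ↔ ∏ i, g i ^ n i = 1) :
    Cardinal.lift.{v} (abRank (Subgroup.closure (Set.range f))) =
      Cardinal.lift.{u} (abRank (Subgroup.closure (Set.range g))) := by
  obtain ⟨L, hL, hL0⟩ := exists_surjective_linearMap_closure_range f
  obtain ⟨M, hM, hM0⟩ := exists_surjective_linearMap_closure_range g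
  have hker : LinearMap.ker L = LinearMap.ker M := by
    ext n
    rw [LinearMap.mem_ker, LinearMap.mem_ker, hL0, hM0, h]
  exact ((L.quotKerEquivOfSurjective hL).symm.trans (Submodule.quotEquivOfEq _ _ hker) |>.trans
    (M.quotKerEquivOfSurjective hM)).lift_rank_eq

variable (k : ℕ)

lemma groupCuspValues_eq_closure_range :
    groupCuspValues k = Subgroup.closure (Set.range fun i : Fin (k - 1) ↦
      cuspUnit (2 * k + 1) (i + 1) (by omega)) := by
  rw [groupCuspValues]
  congr 1
  ext u
  constructor
  · rintro ⟨m, h0, hk, hu⟩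
    obtain ⟨i, rfl⟩ := Nat.exists_eq_add_of_le' h0
    exact ⟨⟨i, by omega⟩, Units.ext hu.symm⟩
  · rintro ⟨i, rfl⟩
    exact ⟨i + 1, by omega, by omega, rfl⟩

lemma groupUR_eq_closure_range :
    groupUR k = Subgroup.closure (Set.range fun i : Fin (k - 1) ↦
      sUnit (2 * k + 1) (i + 1) (by omega)) := by
  rw [groupUR]
  congr 1
  ext u
  constructor
  · rintro ⟨m, h, h0, hk, rfl⟩
    obtain ⟨i, rfl⟩ := Nat.exists_eq_add_of_le' h0
    exact ⟨⟨i, by omega⟩, rfl⟩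
  · rintro ⟨i, rfl⟩
    exact ⟨i + 1, by omega, by omega, by omega, rfl⟩

lemma abRank_groupCuspValues_eq_abRank_groupUR (hp : (2 * k + 1).Prime) :
    abRank (groupCuspValues k) = abRank (groupUR k) := by
  have hm (i : Fin (k - 1)) : 2 * ((i : ℕ) + 1) < 2 * k + 1 := by omega
  rw [groupCuspValues_eq_closure_range, groupUR_eq_closure_range]
  simpa only [Cardinal.lift_id] using abRank_closure_range_eq _ _ fun n ↦
    ⟨prod_sUnit_zpow_eq_one_of_prod_cuspUnit hp rfl hm, prod_cuspUnit_zpow_eq_one_of_prod_sUnit hm⟩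

end Rank

end

theorem theorem1p4 (ℓ k : ℕ) (hℓk : ℓ = 2 * k + 1) (hℓ : 5 ≤ ℓ) :
    (∀ m : ℕ, 1 ≤ m → m ≤ k - 1 →
      Tendsto (sFun ℓ m) atCuspZero (𝓝 (cuspValue ℓ m)) ∧
      ∃ u ∈ cyclotomicUnits ℓ, (u : ℂ) = cuspValue ℓ m) ∧
    (ℓ.Prime → abRank (groupCuspValues k) = abRank (groupUR k)) := by
  subst hℓk
  refine ⟨fun m _ hm ↦ ?_, abRank_groupCuspValues_eq_abRank_groupUR k⟩
  have hml : 2 * m < 2 * k + 1 := by omega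
  exact ⟨tendsto_sFun hml, exists_mem_cyclotomicUnits_eq_cuspValue rfl hml⟩
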